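/- Let $d\ge 1$, $k\ge 1$, $z>0$, $\beta\ge 0$, and let $\Phi:[0,\infty)\to[0,\infty]$ be (not necessarily strictly) decreasing; the value $\infty$ is allowed, so $\Phi$ may blow up at the origin, e.g. $\Phi(r)=r^{2-d}$ for $d\ge 3$. Let $\mathbf N$ be the set of locally finite subsets $\gamma$ of $\mathbb R^d$, with the $\sigma$-field generated by the maps $\gamma\mapsto \#(\gamma\cap B)$, $B\subseteq\mathbb R^d$ Borel. For $\gamma\subseteq\mathbb R^d$ and $x\in\mathbb R^d$ let $v^i(x,\gamma)$ be the $i$-th nearest neighbour of $x$ among the points of $\gamma\setminus\{x\}$ (ties are broken by the lexicographic order), and let $V^k(x,\gamma)$ be the set of the first $k$ neighbours (of all points of $\gamma\setminus\{x\}$ if there are fewer than $k$). Put $$h(x,\gamma)=\sum_{y\in V^k(x,\gamma)}\Phi(\|x-y\|)+\sum_{y\in\gamma}\mathbf 1\{x\in V^k(y,\gamma\cup\{x\})\}\bigl[\Phi(\|y-x\|)-\Phi(\|y-v^k(y,\gamma)\|)\bigr],$$ where $\Phi(\|y-v^k(y,\gamma)\|)$ is read as $0$ if $\gamma\setminus\{y\}$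 has fewer than $k$ points and $\infty-\infty$ is read as $0$, and let $\lambda^*(x,\gamma)=z\,e^{-\beta h(x,\gamma)}$ (with $e^{-\infty}=0$ and $0\cdot\infty=0$). Let $\Gamma$ be a stationary Gibbs point process in $\mathbb R^d$ with Papangelou intensity $\lambda^*$, that is, a random element of $\mathbf N$ with translation-invariant law such that for all measurable $f:\mathbb R^d\times\mathbf N\to[0,\infty]$ $$\mathbb E\sum_{x\in\Gamma}f(x,\Gamma\setminus\{x\})=\mathbb E\int_{\mathbb R^d}f(x,\Gamma)\,\lambda^*(x,\Gamma)\,dx .$$ For bounded Borel $\Lambda\subset\mathbb R^d$ let $N_\Lambda=\#(\Gamma\cap\Lambda)$. Then $\Gamma$ is not hyperuniform, i.e. it is not true that $\operatorname{Var}(N_{\Lambda_n})/|\Lambda_n|\to 0$ for all sequences $\Lambda_1\subseteq\Lambda_2\subseteq\cdots$ of bounded Borel sets with union $\mathbb R^d$. Moreover, there is a constant $C>0$ such that $\operatorname{Var}(N_\Lambda)\ge C\,|\Lambda|$ for every bounded Borel set $\Lambda\subset\mathbb R^d$; in particular, $\operatorname{Var}(N_{\Lambda_n})/|\Lambda_n|\to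 0$ for no such sequence. -/

import Mathlib

open MeasureTheory ProbabilityTheory Filter Topology
open scoped ENNReal NNReal

/-- The space `ℝ^d` with its Euclidean norm. -/
abbrev Pt (d : ℕ) : Type := EuclideanSpace ℝ (Fin d)

/-- Locally finite configurations: sets of points with finitely many points in every
bounded set. -/
@[ext]
structure Config (d : ℕ) where
  carrier : Set (Pt d)
  locallyFinite : ∀ Λ : Set (Pt d), Bornology.IsBounded Λ → (carrier ∩ Λ).Finite

namespace Config

variable {d : ℕ}

/-- The smallest `σ`-field for which all the counting maps `γ ↦ #(γ ∩ B)`, `B` Borel, are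
measurable. -/
noncomputable instance : MeasurableSpace (Config d) :=
  ⨆ B : {B : Set (Pt d) // MeasurableSet B},
    MeasurableSpace.comap (fun γ : Config d => (γ.carrier ∩ B.1).encard) ⊤

/-- `γ \ {x}`. -/
def erase (γ : Config d) (x : Pt d) : Config d where
  carrier := γ.carrier \ {x}
  locallyFinite Λ hΛ :=
    (γ.locallyFinite Λ hΛ).subset (Set.inter_subset_inter_left Λ Set.sdiff_subset)

/-- The translated configuration `τ_u γ = {x + u : x ∈ γ}`. -/
def shift (u : Pt d) (γ : Config d) : Config d where
  carrier := (fun x => x + u) '' γ.carrier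
  locallyFinite Λ hΛ := by
    have hb : Bornology.IsBounded ((fun x : Pt d => x + (-u)) '' Λ) :=
      (LipschitzWith.of_dist_le_mul (K := 1) (fun x y => by simp)).isBounded_image hΛ
    refine ((γ.locallyFinite _ hb).image (fun x => x + u)).subset ?_
    rintro _ ⟨⟨x, hx, rfl⟩, hxΛ⟩
    exact ⟨x, ⟨hx, ⟨x + u, hxΛ, by simp⟩⟩, rfl⟩

/-- `N_Λ(γ)`, the number of points of `γ` in the bounded set `Λ`, as a real number. -/
noncomputable def count (Λ : Set (Pt d)) (γ : Config d) : ℝ :=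
  ((γ.carrier ∩ Λ).ncard : ℝ)

end Config

/-- `w` comes before `y` in the list of neighbours of `x`: it is closer to `x`, or it is at the
same distance and precedes `y` in the lexicographic order of `ℝ^d`. -/
def Closer {d : ℕ} (x w y : Pt d) : Prop :=
  dist x w < dist x y ∨
    (dist x w = dist x y ∧ toLex (WithLp.ofLp w) < toLex (WithLp.ofLp y))

/-- `y = v^i(x, γ)`: the point `y` is the `i`-th nearest neighbour (`i = 1, 2, …`) of `x` among
the points of `γ` different from `x`. There is at most one such `y`, and there is none if `γ` has
fewer than `i` points different from `x`. -/
def IsNeighbour {d : ℕ} (i : ℕ) (x : Pt d) (γ : Set (Pt d)) (y : Pt d) : Prop :=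
  y ∈ γ \ {x} ∧ {w ∈ γ \ {x} | Closer x w y}.encard + 1 = i

/-- `V^k(x, γ)`, the set of the first `k` neighbours of `x` in `γ` (of all the points of `γ`
different from `x`, if there are fewer than `k`). -/
def neighbours {d : ℕ} (k : ℕ) (x : Pt d) (γ : Set (Pt d)) : Set (Pt d) :=
  {y | ∃ i : ℕ, 1 ≤ i ∧ i ≤ k ∧ IsNeighbour i x γ y}

/-- `Φ(x - v^i(x, γ))` for the radial function `x ↦ Φ(‖x‖)`. The sum has at most one term; it is
`0` if `x` has fewer than `i` neighbours in `γ`. -/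
noncomputable def neighbourPotential {d : ℕ} (Φ : ℝ≥0 → ℝ≥0∞) (i : ℕ) (x : Pt d)
    (γ : Set (Pt d)) : ℝ≥0∞ :=
  ∑' y : {y : Pt d // IsNeighbour i x γ y}, Φ ‖x - y.1‖₊

open scoped Classical in
/-- The local energy `h(x, γ)` of the `k`-nearest-neighbour interaction
`H(γ) = ∑_{x ∈ γ} ∑_{y ∈ V^k(x, γ)} Φ(x - y)`, for a radial decreasing `Φ ≥ 0`:
`h(x, γ) = ∑_{y ∈ V^k(x, γ)} Φ(x - y)
  + ∑_{y ∈ γ} 1{x ∈ V^k(y, γ ∪ {x})} [Φ(y - x) - Φ(y - v^k(y, γ))]`.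
When `x ∈ V^k(y, γ ∪ {x})`, `x` is at most as far from `y` as `v^k(y, γ)` is, so that the bracket
is non-negative for a decreasing `Φ` and the truncated subtraction of `ℝ≥0∞` is the true one
(with `∞ - ∞ = 0`). -/
noncomputable def localEnergy {d : ℕ} (Φ : ℝ≥0 → ℝ≥0∞) (k : ℕ) (x : Pt d)
    (γ : Set (Pt d)) : ℝ≥0∞ :=
  (∑' y : neighbours k x γ, Φ ‖x - y.1‖₊) +
    ∑' y : γ, if x ∈ neighbours k y.1 (insert x γ) then
      Φ ‖y.1 - x‖₊ - neighbourPotential Φ k y.1 γ else 0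

/-- The Papangelou intensity `λ*(x, γ) = z exp(-β h(x, γ))`, with `exp(-∞) = 0`. -/
noncomputable def papangelou {d : ℕ} (z β : ℝ) (Φ : ℝ≥0 → ℝ≥0∞) (k : ℕ) (x : Pt d)
    (γ : Set (Pt d)) : ℝ≥0∞ :=
  ENNReal.ofReal z *
    EReal.exp (-((ENNReal.ofReal β * localEnergy Φ k x γ : ℝ≥0∞) : EReal))

/-- The point process with law `P` is a Gibbs point process with Papangelou intensity `lam`: it
solves the Georgii--Nguyen--Zessin equations. -/
def IsGibbs {d : ℕ} (lam : Pt d → Set (Pt d) → ℝ≥0∞) (P : Measure (Config d)) : Prop :=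
  ∀ f : Pt d × Config d → ℝ≥0∞, Measurable f →
    ∫⁻ γ, ∑' x : γ.carrier, f (x.1, γ.erase x.1) ∂P =
      ∫⁻ γ, ∫⁻ x, f (x, γ) * lam x γ.carrier ∂volume ∂P

/-- The law `P` is invariant under all translations. -/
def IsStationaryProcess {d : ℕ} (P : Measure (Config d)) : Prop :=
  ∀ u : Pt d, MeasurePreserving (Config.shift u) P P

/-- `Λ 0 ⊆ Λ 1 ⊆ …` is a sequence of bounded Borel sets that increases to `ℝ^d`. -/
structure IncreasesToSpace {d : ℕ} (Λ : ℕ → Set (Pt d)) : Prop where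
  bounded : ∀ n, Bornology.IsBounded (Λ n)
  measurable : ∀ n, MeasurableSet (Λ n)
  monotone : Monotone Λ
  exhausts : ⋃ n, Λ n = Set.univ

/-- Hyperuniformity: `Var(N_Λ) / |Λ| → 0` as `Λ` increases to `ℝ^d`. The variance is taken with
values in `[0, ∞]`, so that it is the true one in all cases. -/
def IsHyperuniform {d : ℕ} (P : Measure (Config d)) : Prop :=
  ∀ Λ : ℕ → Set (Pt d), IncreasesToSpace Λ →
    Tendsto (fun n => evariance (Config.count (Λ n)) P / volume (Λ n)) atTop (𝓝 0)

/-! The number of points is tested against an innovation. For a weight `g` with values in [0,1], let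
S be the sum of g(x, Γ \ {x}) over the points x of Γ in Λ, and A the integral of a(x, Γ) = g(x, Γ)
λ*(x, Γ) over Λ. The GNZ equation gives E S = E A, and E[N S] = E[N A] + E A, because N also counts
the point x itself. Hence Cov(N, S - A) = E A. If E A = c|Λ| and E(S - A)² ≤ K|Λ|, Cauchy–Schwarz
yields Var N ≥ (c²/K)|Λ|.

The bound on E(S - A)² holds when `g` and g λ* have finite range R: pairs at distance more than R
contribute the same `farMoment` to E S², E A² and E[S A] and cancel, while the remaining pairs
contribute O(|Λ|) since λ* ≤ z. The intensity itself has no finite range, so `g` must select points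
where it does. It is the indicator that x is surrounded: in each direction of a finite 1/2-net of
the sphere there are k + 1 points at distance about ρ. Then x is not among the k nearest neighbours
of any point at distance ρ or more, and the energy at x depends only on points within 4ρ
(`IsSphereNet.localEnergy_sdiff_far`).

It remains that c > 0. No lower bound on λ* at surrounded points is required, as c is also the mean
number of surrounded points per unit volume. The GNZ equation excludes the empty configuration,
stationarity then excludes finite ones, and in an infinite stationary configuration surrounded
points occur once ρ is large. -/

namespace Config

variable {d : ℕ}

/-! ### Measurability on the space of configurations -/

theorem measurable_encard_inter {B : Set (Pt d)} (hB : MeasurableSet B) :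
    Measurable fun γ : Config d => (γ.carrier ∩ B).encard :=
  (comap_measurable _).mono
    (le_iSup (fun B : {B : Set (Pt d) // MeasurableSet B} =>
      MeasurableSpace.comap (fun γ : Config d => (γ.carrier ∩ B.1).encard) ⊤) ⟨B, hB⟩) le_rfl

theorem measurable_of_encard_inter {α : Type*} [MeasurableSpace α] {F : α → Config d}
    (h : ∀ B : Set (Pt d), MeasurableSet B → Measurable fun a => ((F a).carrier ∩ B).encard) :
    Measurable F := by
  rw [measurable_iff_comap_le]
  refine (MeasurableSpace.comap_iSup (m := fun B : {B : Set (Pt d) // MeasurableSet B} =>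
    MeasurableSpace.comap (fun γ : Config d => (γ.carrier ∩ B.1).encard) ⊤)).trans_le
    (iSup_le fun B => ?_)
  rw [MeasurableSpace.comap_comp]
  exact (h B.1 B.2).comap_le

theorem finite_inter (γ : Config d) {Λ : Set (Pt d)} (hΛ : Bornology.IsBounded Λ) :
    (γ.carrier ∩ Λ).Finite := γ.locallyFinite Λ hΛ

/-- The counting measure of a configuration. -/
noncomputable def counting (γ : Config d) : Measure (Pt d) :=
  Measure.sum fun x : γ.carrier => Measure.dirac x.1

theorem lintegral_counting (γ : Config d) (f : Pt d → ℝ≥0∞) :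
    ∫⁻ x, f x ∂γ.counting = ∑' x : γ.carrier, f x.1 := by
  simp [counting, lintegral_sum_measure]

theorem counting_apply (γ : Config d) {B : Set (Pt d)} (hB : MeasurableSet B) :
    γ.counting B = ((γ.carrier ∩ B).encard : ℝ≥0∞) := by
  rw [← lintegral_indicator_one hB, lintegral_counting, ← ENNReal.tsum_set_one,
    tsum_subtype γ.carrier (B.indicator 1), tsum_subtype (γ.carrier ∩ B) fun _ => (1 : ℝ≥0∞),
    Set.indicator_indicator]
  rfl

theorem measurable_counting : Measurable (counting : Config d → Measure (Pt d)) := by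
  refine Measure.measurable_of_measurable_coe _ fun B hB => ?_
  simp_rw [counting_apply _ hB]
  exact (measurable_from_top (f := fun n : ℕ∞ => (n : ℝ≥0∞))).comp (measurable_encard_inter hB)

/-- The kernel that maps a configuration to its counting measure. -/
noncomputable def countingKernel (d : ℕ) : Kernel (Config d) (Pt d) :=
  ⟨counting, measurable_counting⟩

theorem countingKernel_apply (γ : Config d) : countingKernel d γ = γ.counting := rfl

/-- The counting measures have no uniform bound, even on a fixed bounded set. Splitting by annulus
and by the number of points in it gives pieces bounded by that number. Fubini-type measurability for
sums over points rests on this. -/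
instance : IsSFiniteKernel (countingKernel d) := by
  classical
  let s : ℕ → Set (Pt d) := fun n => {x | ⌊‖x‖⌋₊ = n}
  have hs : ∀ n, MeasurableSet (s n) := fun n =>
    (Nat.measurable_floor.comp measurable_norm) (measurableSet_singleton n)
  have hb : ∀ n, Bornology.IsBounded (s n) := fun n => by
    refine (Metric.isBounded_ball (x := (0 : Pt d)) (r := n + 1)).subset fun x hx => ?_
    rw [mem_ball_zero_iff]
    have h := Nat.lt_floor_add_one ‖x‖
    rwa [show ⌊‖x‖⌋₊ = n from hx] at h
  let A : ℕ × ℕ → Set (Config d) := fun p => {γ | (γ.carrier ∩ s p.1).encard = p.2}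
  have hA : ∀ p, MeasurableSet (A p) := fun p =>
    measurable_encard_inter (hs p.1) (measurableSet_singleton ((p.2 : ℕ) : ℕ∞))
  let κ : ℕ × ℕ → Kernel (Config d) (Pt d) := fun p =>
    Kernel.piecewise (hA p) ((countingKernel d).restrict (hs p.1)) 0
  have hκ : ∀ p, IsFiniteKernel (κ p) := fun p => by
    refine ⟨⟨p.2, ENNReal.natCast_lt_top _, fun γ => ?_⟩⟩
    rw [Kernel.piecewise_apply']
    split_ifs with h
    · rw [Kernel.restrict_apply, Measure.restrict_apply_univ, countingKernel_apply,
        counting_apply _ (hs _), show (γ.carrier ∩ s p.1).encard = p.2 from h]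
      simp
    · simp
  have : countingKernel d = Kernel.sum κ := by
    ext γ B hB
    rw [Kernel.sum_apply' _ _ hB, ENNReal.tsum_prod (f := fun n m => κ (n, m) γ B)]
    have h1 : ∀ n, ∑' m, κ (n, m) γ B = (countingKernel d γ).restrict (s n) B := by
      intro n
      obtain ⟨m, hm⟩ : ∃ m : ℕ, (γ.carrier ∩ s n).encard = m :=
        ⟨_, (γ.finite_inter (hb n)).cast_ncard_eq.symm⟩
      rw [tsum_eq_single m]
      · have : γ ∈ A (n, m) := hm
        rw [Kernel.piecewise_apply', if_pos this, Kernel.restrict_apply]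
      · intro m' hm'
        have : γ ∉ A (n, m') := fun h => hm' (by
          have h' : (γ.carrier ∩ s n).encard = m' := h
          rw [hm] at h'
          exact_mod_cast h'.symm)
        rw [Kernel.piecewise_apply', if_neg this]
        simp
    simp_rw [h1, Measure.restrict_apply hB]
    rw [← measure_iUnion]
    · congr 1
      ext x
      simp [s]
    · intro i j hij
      refine Set.disjoint_left.2 fun x hx hx' => hij ?_
      exact (hx.2 : _ = i).symm.trans hx'.2
    · exact fun n => hB.inter (hs n)
  rw [this]
  infer_instance

/-- Sums over the points of a random configuration are measurable in all parameters. -/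
theorem measurable_tsum {α : Type*} [MeasurableSpace α] {f : α → Pt d → ℝ≥0∞} {F : α → Config d}
    (hF : Measurable F) (hf : Measurable (Function.uncurry f)) :
    Measurable fun a => ∑' x : (F a).carrier, f a x.1 := by
  have := Measurable.lintegral_kernel_prod_right (κ := (countingKernel d).comap F hF) hf
  simpa [Kernel.comap_apply, countingKernel_apply, lintegral_counting] using this

open scoped Classical in
theorem encard_sep_eq_tsum (γ : Set (Pt d)) (p : Pt d → Prop) :
    (({x ∈ γ | p x}.encard : ℕ∞) : ℝ≥0∞) = ∑' x : γ, if p x.1 then 1 else 0 := by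
  rw [← ENNReal.tsum_set_one, tsum_subtype γ fun x => if p x then (1 : ℝ≥0∞) else 0,
    tsum_subtype {x ∈ γ | p x} fun _ => (1 : ℝ≥0∞)]
  refine tsum_congr fun x => ?_
  by_cases h : x ∈ γ <;> by_cases h' : p x <;> simp [h, h']

theorem measurable_encard_sep {α : Type*} [MeasurableSpace α] {F : α → Config d}
    (hF : Measurable F) {p : α → Pt d → Prop}
    (hp : MeasurableSet {q : α × Pt d | p q.1 q.2}) :
    Measurable fun a => {x ∈ (F a).carrier | p a x}.encard := by
  classical
  have h : Measurable fun a => (({x ∈ (F a).carrier | p a x}.encard : ℕ∞) : ℝ≥0∞) := by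
    simp_rw [encard_sep_eq_tsum]
    exact measurable_tsum hF (f := fun a x => if p a x then 1 else 0)
      (Measurable.ite hp measurable_const measurable_const)
  refine measurable_to_countable' fun n => ?_
  have h2 := h (measurableSet_singleton (n : ℝ≥0∞))
  convert h2 using 1
  ext a
  simp

theorem measurableSet_mem {α : Type*} [MeasurableSpace α] {F : α → Config d}
    (hF : Measurable F) {y : α → Pt d} (hy : Measurable y) :
    MeasurableSet {a | y a ∈ (F a).carrier} := by
  have h := measurable_encard_sep hF (p := fun a x => x = y a)
    (measurableSet_eq_fun measurable_snd (hy.comp measurable_fst))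
  have h2 := h (measurableSet_singleton (0 : ℕ∞)).compl
  convert h2 using 1
  ext a
  simp only [Set.mem_ofPred_eq, Set.mem_preimage, Set.mem_compl_iff, Set.mem_singleton_iff,
    Set.encard_eq_zero]
  rw [← ne_eq, ← Set.nonempty_iff_ne_empty]
  exact ⟨fun h => ⟨_, h, rfl⟩, fun ⟨x, hx, hxy⟩ => hxy ▸ hx⟩

theorem measurable_erase {α : Type*} [MeasurableSpace α] {F : α → Config d}
    (hF : Measurable F) {y : α → Pt d} (hy : Measurable y) :
    Measurable fun a => (F a).erase (y a) := by
  refine measurable_of_encard_inter fun B hB => ?_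
  have h := measurable_encard_sep hF (p := fun a x => x ∈ B ∧ x ≠ y a)
    ((measurable_snd hB).inter
      (measurableSet_eq_fun measurable_snd (hy.comp measurable_fst)).compl)
  convert h using 3 with a
  ext x
  simp [erase]
  tauto

end Config

/-! ### Measurability and bounds of the Papangelou intensity -/

section Measurability

variable {d : ℕ} {α : Type*} [MeasurableSpace α] {F : α → Config d}

theorem measurableSet_closer {x w y : α → Pt d} (hx : Measurable x) (hw : Measurable w)
    (hy : Measurable y) : MeasurableSet {a | Closer (x a) (w a) (y a)} := by
  have hc : ∀ {u : α → Pt d}, Measurable u → ∀ i, Measurable fun a => u a i := fun hu i =>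
    (EuclideanSpace.proj (𝕜 := ℝ) i).continuous.measurable.comp hu
  have hlex : MeasurableSet {a | toLex (WithLp.ofLp (w a)) < toLex (WithLp.ofLp (y a))} := by
    have : {a | toLex (WithLp.ofLp (w a)) < toLex (WithLp.ofLp (y a))} =
        ⋃ i, (⋂ j, ⋂ (_ : j < i), {a | w a j = y a j}) ∩ {a | w a i < y a i} := by
      ext a
      simp only [Set.mem_iUnion, Set.mem_inter_iff, Set.mem_iInter]
      rfl
    rw [this]
    exact .iUnion fun i => (MeasurableSet.iInter fun j => .iInter fun _ =>
      measurableSet_eq_fun (hc hw j) (hc hy j)).inter (measurableSet_lt (hc hw i) (hc hy i))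
  exact (measurableSet_lt (hx.dist hw) (hx.dist hy)).union
    ((measurableSet_eq_fun (hx.dist hw) (hx.dist hy)).inter hlex)

theorem measurableSet_isNeighbour (hF : Measurable F) (i : ℕ) {x y : α → Pt d}
    (hx : Measurable x) (hy : Measurable y) :
    MeasurableSet {a | IsNeighbour i (x a) (F a).carrier (y a)} := by
  have h1 : MeasurableSet {a | y a ∈ (F a).carrier \ {x a}} :=
    (Config.measurableSet_mem hF hy).inter (measurableSet_eq_fun hy hx).compl
  have h2 := Config.measurable_encard_sep (Config.measurable_erase hF hx)
    (p := fun a w => Closer (x a) w (y a))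
    (measurableSet_closer (hx.comp measurable_fst) measurable_snd (hy.comp measurable_fst))
  exact h1.inter ((measurable_from_top (f := fun n : ℕ∞ => n + 1)).comp h2
    (measurableSet_singleton (i : ℕ∞)))

theorem measurableSet_mem_neighbours (hF : Measurable F) (k : ℕ) {x y : α → Pt d}
    (hx : Measurable x) (hy : Measurable y) :
    MeasurableSet {a | y a ∈ neighbours k (x a) (F a).carrier} := by
  have : {a | y a ∈ neighbours k (x a) (F a).carrier} =
      ⋃ i : ℕ, ⋃ (_ : 1 ≤ i), ⋃ (_ : i ≤ k), {a | IsNeighbour i (x a) (F a).carrier (y a)} := by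
    ext a
    simp only [Set.mem_iUnion, exists_prop]
    rfl
  rw [this]
  exact .iUnion fun i => .iUnion fun _ => .iUnion fun _ => measurableSet_isNeighbour hF i hx hy

theorem not_closer_self (x w : Pt d) : ¬ Closer x w w := by
  rintro (h | ⟨-, h⟩) <;> exact lt_irrefl _ h

/-- A point does not precede itself, so its rank can be computed without the insertion. -/
theorem isNeighbour_insert_self {i : ℕ} {x y : Pt d} {γ : Set (Pt d)} :
    IsNeighbour i y (insert x γ) x ↔
      x ≠ y ∧ {w ∈ γ \ {y} | Closer y w x}.encard + 1 = i := by
  have : {w ∈ insert x γ \ {y} | Closer y w x} = {w ∈ γ \ {y} | Closer y w x} := by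
    ext w
    refine ⟨fun ⟨⟨h1, h2⟩, h3⟩ => ⟨⟨h1.resolve_left ?_, h2⟩, h3⟩,
      fun ⟨⟨h1, h2⟩, h3⟩ => ⟨⟨Or.inr h1, h2⟩, h3⟩⟩
    rintro rfl
    exact not_closer_self _ _ h3
  rw [IsNeighbour, this]
  simp

theorem measurableSet_mem_neighbours_insert (hF : Measurable F) (k : ℕ) {x y : α → Pt d}
    (hx : Measurable x) (hy : Measurable y) :
    MeasurableSet {a | x a ∈ neighbours k (y a) (insert (x a) (F a).carrier)} := by
  have h2 := Config.measurable_encard_sep (Config.measurable_erase hF hy)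
    (p := fun a w => Closer (y a) w (x a))
    (measurableSet_closer (hy.comp measurable_fst) measurable_snd (hx.comp measurable_fst))
  have : {a | x a ∈ neighbours k (y a) (insert (x a) (F a).carrier)} =
      ⋃ i : ℕ, ⋃ (_ : 1 ≤ i), ⋃ (_ : i ≤ k), {a | x a ≠ y a} ∩
        {a | {w ∈ (F a).carrier \ {y a} | Closer (y a) w (x a)}.encard + 1 = (i : ℕ∞)} := by
    ext a
    simp only [Set.mem_iUnion, exists_prop, Set.mem_inter_iff]
    simp only [neighbours, Set.mem_ofPred_eq, isNeighbour_insert_self]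
  rw [this]
  exact .iUnion fun i => .iUnion fun _ => .iUnion fun _ =>
    (measurableSet_eq_fun hx hy).compl.inter
      ((measurable_from_top (f := fun n : ℕ∞ => n + 1)).comp h2
        (measurableSet_singleton (i : ℕ∞)))

open scoped Classical in
theorem tsum_subtype_eq_tsum_ite {β : Type*} {s : Set β} {p : β → Prop} (h : ∀ y, p y → y ∈ s)
    (f : β → ℝ≥0∞) : ∑' y : {y // p y}, f y.1 = ∑' y : s, if p y.1 then f y.1 else 0 := by
  rw [tsum_subtype s fun y => if p y then f y else 0]
  refine (tsum_subtype {y | p y} f).trans (tsum_congr fun y => ?_)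
  by_cases hy : p y
  · simp [hy, h y hy]
  · by_cases h' : y ∈ s <;> simp [hy, h']

theorem measurable_potential {Φ : ℝ≥0 → ℝ≥0∞} (hΦ : Antitone Φ) {x y : α → Pt d}
    (hx : Measurable x) (hy : Measurable y) : Measurable fun a => Φ ‖x a - y a‖₊ :=
  hΦ.measurable.comp (hx.sub hy).nnnorm

theorem measurable_neighbourPotential {Φ : ℝ≥0 → ℝ≥0∞} (hΦ : Antitone Φ) (hF : Measurable F)
    (i : ℕ) {x : α → Pt d} (hx : Measurable x) :
    Measurable fun a => neighbourPotential Φ i (x a) (F a).carrier := by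
  classical
  have : ∀ a, neighbourPotential Φ i (x a) (F a).carrier = ∑' y : (F a).carrier,
      if IsNeighbour i (x a) (F a).carrier y.1 then Φ ‖x a - y.1‖₊ else 0 := fun a =>
    tsum_subtype_eq_tsum_ite (p := fun y => IsNeighbour i (x a) (F a).carrier y)
      (fun y hy => hy.1.1) fun y => Φ ‖x a - y‖₊
  simp_rw [this]
  exact Config.measurable_tsum hF (f := fun a y =>
      if IsNeighbour i (x a) (F a).carrier y then Φ ‖x a - y‖₊ else 0) <|
    Measurable.ite (measurableSet_isNeighbour (hF.comp measurable_fst) i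
      (hx.comp measurable_fst) measurable_snd)
      (measurable_potential hΦ (hx.comp measurable_fst) measurable_snd) measurable_const

theorem mem_of_mem_neighbours {k : ℕ} {x y : Pt d} {γ : Set (Pt d)}
    (h : y ∈ neighbours k x γ) : y ∈ γ := by
  obtain ⟨i, -, -, h⟩ := h
  exact h.1.1

theorem measurable_localEnergy {Φ : ℝ≥0 → ℝ≥0∞} (hΦ : Antitone Φ) (hF : Measurable F)
    (k : ℕ) {x : α → Pt d} (hx : Measurable x) :
    Measurable fun a => localEnergy Φ k (x a) (F a).carrier := by
  classical
  refine Measurable.add ?_ ?_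
  · have : ∀ a, (∑' y : neighbours k (x a) (F a).carrier, Φ ‖x a - y.1‖₊) =
        ∑' y : (F a).carrier,
          if y.1 ∈ neighbours k (x a) (F a).carrier then Φ ‖x a - y.1‖₊ else 0 := fun a =>
      tsum_subtype_eq_tsum_ite (p := fun y => y ∈ neighbours k (x a) (F a).carrier)
        (fun y hy => mem_of_mem_neighbours hy) fun y => Φ ‖x a - y‖₊
    simp_rw [this]
    exact Config.measurable_tsum hF (f := fun a y =>
        if y ∈ neighbours k (x a) (F a).carrier then Φ ‖x a - y‖₊ else 0) <|
      Measurable.ite (measurableSet_mem_neighbours (hF.comp measurable_fst) k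
        (hx.comp measurable_fst) measurable_snd)
        (measurable_potential hΦ (hx.comp measurable_fst) measurable_snd) measurable_const
  · refine Config.measurable_tsum hF (f := fun a y =>
        if x a ∈ neighbours k y (insert (x a) (F a).carrier) then
          Φ ‖y - x a‖₊ - neighbourPotential Φ k y (F a).carrier else 0) <|
      Measurable.ite (measurableSet_mem_neighbours_insert (hF.comp measurable_fst) k
        (hx.comp measurable_fst) measurable_snd) ?_ measurable_const
    exact (measurable_potential hΦ measurable_snd (hx.comp measurable_fst)).sub
      (measurable_neighbourPotential hΦ (hF.comp measurable_fst) k measurable_snd)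

theorem measurable_papangelou {Φ : ℝ≥0 → ℝ≥0∞} (hΦ : Antitone Φ) (hF : Measurable F) (z β : ℝ)
    (k : ℕ) {x : α → Pt d} (hx : Measurable x) :
    Measurable fun a => papangelou z β Φ k (x a) (F a).carrier :=
  (EReal.measurable_exp.comp ((measurable_coe_ennreal_ereal.comp
    ((measurable_localEnergy hΦ hF k hx).const_mul _)).neg)).const_mul _

theorem papangelou_le {Φ : ℝ≥0 → ℝ≥0∞} (z β : ℝ) (k : ℕ) (x : Pt d) (γ : Set (Pt d)) :
    papangelou z β Φ k x γ ≤ ENNReal.ofReal z := by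
  refine mul_le_of_le_one_right' ?_
  rw [← EReal.exp_zero]
  refine EReal.exp_monotone ?_
  rw [EReal.neg_le, neg_zero]
  exact EReal.coe_ennreal_nonneg _

/-- This is the only lower information on the intensity that the proof needs; it rules out the empty
configuration. -/
theorem papangelou_empty {Φ : ℝ≥0 → ℝ≥0∞} (z β : ℝ) (k : ℕ) (x : Pt d) :
    papangelou z β Φ k x ∅ = ENNReal.ofReal z := by
  have h : localEnergy Φ k x (∅ : Set (Pt d)) = 0 := by
    have : neighbours k x (∅ : Set (Pt d)) = ∅ :=
      Set.eq_empty_of_forall_notMem fun y hy => mem_of_mem_neighbours hy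
    simp [localEnergy, this]
  simp [papangelou, h]

end Measurability

/-! ### Finite range of the energy at surrounded points -/

section Locality

variable {d : ℕ}

theorem IsNeighbour.dist_le {i : ℕ} {x u : Pt d} {γ : Set (Pt d)} {s : ℝ}
    (h : IsNeighbour i x γ u) (hs : (i : ℕ∞) ≤ {w ∈ γ \ {x} | dist x w ≤ s}.encard) :
    dist x u ≤ s := by
  by_contra! hu
  have h1 : (i : ℕ∞) ≤ {w ∈ γ \ {x} | Closer x w u}.encard :=
    hs.trans (Set.encard_le_encard fun w hw => ⟨hw.1, Or.inl (hw.2.trans_lt hu)⟩)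
  have h2 := h.2
  rw [← h2] at h1
  -- Finiteness is essential: n + 1 ≤ n is contradictory in `ℕ∞` only for n ≠ ⊤.
  have h3 : {w ∈ γ \ {x} | Closer x w u}.encard ≠ ⊤ := by
    intro h3
    rw [h3] at h2
    exact absurd h2 (by simp)
  exact absurd h1 (not_le.2 (ENat.lt_add_one_iff h3 |>.2 le_rfl))

theorem sep_closer_sdiff_singleton {x u y : Pt d} {γ : Set (Pt d)}
    (h : dist x u < dist x y) :
    {w ∈ (γ \ {y}) \ {x} | Closer x w u} = {w ∈ γ \ {x} | Closer x w u} := by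
  ext w
  refine ⟨fun ⟨⟨h1, h2⟩, h3⟩ => ⟨⟨h1.1, h2⟩, h3⟩,
    fun ⟨⟨h1, h2⟩, h3⟩ => ⟨⟨⟨h1, ?_⟩, h2⟩, h3⟩⟩
  rintro rfl
  rcases h3 with h3 | h3
  · exact lt_asymm h h3
  · exact h.ne' h3.1

/-- The i-th neighbour lies within s, strictly nearer than y, so y neither is that neighbour nor
enters its rank. Counting in the smaller set γ \ {y} serves both directions. -/
theorem isNeighbour_sdiff_singleton {i : ℕ} {x u y : Pt d} {γ : Set (Pt d)} {s : ℝ}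
    (hs : (i : ℕ∞) ≤ {w ∈ (γ \ {y}) \ {x} | dist x w ≤ s}.encard) (hy : s < dist x y) :
    IsNeighbour i x (γ \ {y}) u ↔ IsNeighbour i x γ u := by
  constructor
  · intro h
    have hu := (h.dist_le hs).trans_lt hy
    refine ⟨⟨h.1.1.1, h.1.2⟩, ?_⟩
    rw [← sep_closer_sdiff_singleton hu]
    exact h.2
  · intro h
    have hu := (h.dist_le (hs.trans
      (Set.encard_le_encard fun w hw => ⟨⟨hw.1.1.1, hw.1.2⟩, hw.2⟩))).trans_lt hy
    refine ⟨⟨⟨h.1.1, fun h' => ?_⟩, h.1.2⟩, ?_⟩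
    · rw [Set.mem_singleton_iff.1 h'] at hu
      exact lt_irrefl _ hu
    · rw [sep_closer_sdiff_singleton hu]
      exact h.2

theorem neighbours_sdiff_singleton {k : ℕ} {x y : Pt d} {γ : Set (Pt d)} {s : ℝ}
    (hs : (k : ℕ∞) ≤ {w ∈ (γ \ {y}) \ {x} | dist x w ≤ s}.encard) (hy : s < dist x y) :
    neighbours k x (γ \ {y}) = neighbours k x γ := by
  ext u
  refine exists_congr fun i => and_congr_right fun _ => and_congr_right fun hi => ?_
  exact isNeighbour_sdiff_singleton (le_trans (by exact_mod_cast hi) hs) hy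

theorem neighbourPotential_sdiff_singleton {Φ : ℝ≥0 → ℝ≥0∞} {k : ℕ} {x y : Pt d}
    {γ : Set (Pt d)} {s : ℝ}
    (hs : (k : ℕ∞) ≤ {w ∈ (γ \ {y}) \ {x} | dist x w ≤ s}.encard) (hy : s < dist x y) :
    neighbourPotential Φ k x (γ \ {y}) = neighbourPotential Φ k x γ := by
  have : (fun u => IsNeighbour k x (γ \ {y}) u) = fun u => IsNeighbour k x γ u := by
    ext u
    exact isNeighbour_sdiff_singleton hs hy
  unfold neighbourPotential
  rw [this]

theorem notMem_neighbours_insert {k : ℕ} {x w : Pt d} {γ : Set (Pt d)}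
    (h : (k : ℕ∞) ≤ {p ∈ γ \ {w} | dist w p < dist w x}.encard) :
    x ∉ neighbours k w (insert x γ) := by
  rintro ⟨i, -, hi, h'⟩
  rw [isNeighbour_insert_self] at h'
  have h1 : (i : ℕ∞) ≤ {p ∈ γ \ {w} | Closer w p x}.encard :=
    le_trans (by exact_mod_cast hi)
      (h.trans (Set.encard_le_encard fun p hp => ⟨hp.1, Or.inl hp.2⟩))
  have h2 := h'.2
  rw [← h2] at h1
  have h3 : {p ∈ γ \ {w} | Closer w p x}.encard ≠ ⊤ := by
    intro h3
    rw [h3] at h2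
    exact absurd h2 (by simp)
  exact absurd h1 (not_le.2 (ENat.lt_add_one_iff h3 |>.2 le_rfl))

theorem mem_neighbours_insert_sdiff_singleton {k : ℕ} {x w y : Pt d} {γ : Set (Pt d)}
    (h : dist w x < dist w y) :
    x ∈ neighbours k w (insert x (γ \ {y})) ↔ x ∈ neighbours k w (insert x γ) := by
  refine exists_congr fun i => and_congr_right fun _ => and_congr_right fun hi => ?_
  rw [isNeighbour_insert_self, isNeighbour_insert_self, sep_closer_sdiff_singleton h]

/-- `T` is a finite nonempty `1/2`-net of the unit sphere. -/
structure IsSphereNet (T : Finset (Pt d)) : Prop where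
  nonempty : T.Nonempty
  norm_eq : ∀ t ∈ T, ‖t‖ = 1
  exists_dist_lt : ∀ u : Pt d, ‖u‖ = 1 → ∃ t ∈ T, dist u t < 1 / 2

theorem exists_isSphereNet (hd : 1 ≤ d) : ∃ T : Finset (Pt d), IsSphereNet T := by
  have : Nonempty (Fin d) := ⟨⟨0, hd⟩⟩
  obtain ⟨t, ht, hfin, hcov⟩ := Metric.finite_approx_of_totallyBounded
    (isCompact_sphere (0 : Pt d) 1).totallyBounded (1 / 2) (by norm_num)
  have key : ∀ u : Pt d, ‖u‖ = 1 → ∃ t ∈ hfin.toFinset, dist u t < 1 / 2 := fun u hu => by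
    have := hcov (mem_sphere_zero_iff_norm.2 hu)
    simp only [Set.mem_iUnion, Metric.mem_ball, exists_prop] at this
    simpa using this
  refine ⟨hfin.toFinset, ?_, fun s hs => ?_, key⟩
  · obtain ⟨u, hu⟩ := exists_norm_eq (Pt d) zero_le_one
    obtain ⟨t, ht, -⟩ := key u hu
    exact ⟨t, ht⟩
  · exact mem_sphere_zero_iff_norm.1 (ht (hfin.mem_toFinset.1 hs))

/-- In each of the directions of `T`, a ball of radius `ρ / 2` at distance `ρ` from `x` contains
at least `m` points of `γ`. -/
def IsSurrounded (T : Finset (Pt d)) (ρ : ℝ) (m : ℕ) (x : Pt d) (γ : Set (Pt d)) : Prop :=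
  ∀ t ∈ T, (m : ℕ∞) ≤ (γ ∩ Metric.ball (x + ρ • t) (ρ / 2)).encard

/-- This is why surroundedness asks for k + 1 points: one of them may be the point w whose
neighbours are being counted. -/
theorem le_encard_sdiff_singleton {α : Type*} {s : Set α} {k : ℕ} (w : α)
    (h : ((k + 1 : ℕ) : ℕ∞) ≤ s.encard) : (k : ℕ∞) ≤ (s \ {w}).encard := by
  have h1 : (k : ℕ∞) + 1 ≤ (s \ {w}).encard + 1 := by
    refine le_trans (by exact_mod_cast h) ?_
    by_cases hw : w ∈ s
    · exact (Set.encard_sdiff_singleton_add_one hw).ge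
    · rw [Set.sdiff_singleton_eq_self hw]
      exact le_self_add
  exact (ENat.add_le_add_iff_right (by simp)).1 h1

variable {T : Finset (Pt d)} {ρ : ℝ}

theorem IsSphereNet.dist_add_smul (hT : IsSphereNet T) (hρ : 0 < ρ) (x : Pt d) {t : Pt d}
    (ht : t ∈ T) : dist x (x + ρ • t) = ρ := by
  rw [dist_self_add_right, norm_smul, hT.norm_eq t ht, mul_one, Real.norm_of_nonneg hρ.le]

theorem isSurrounded_sdiff_singleton {m : ℕ} {x y : Pt d} {γ : Set (Pt d)}
    (h : ∀ t ∈ T, y ∉ Metric.ball (x + ρ • t) (ρ / 2)) :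
    IsSurrounded T ρ m x (γ \ {y}) ↔ IsSurrounded T ρ m x γ := by
  refine forall₂_congr fun t ht => ?_
  have : (γ \ {y}) ∩ Metric.ball (x + ρ • t) (ρ / 2) = γ ∩ Metric.ball (x + ρ • t) (ρ / 2) := by
    ext w
    refine ⟨fun h => ⟨h.1.1, h.2⟩, fun hw => ⟨⟨hw.1, ?_⟩, hw.2⟩⟩
    rintro rfl
    exact h t ht hw.2
  rw [this]

/-- The ball centres are at distance ρ from x and the radii are ρ/2, so x lies in none of the balls.
-/
theorem IsSphereNet.isSurrounded_sdiff_self (hT : IsSphereNet T) (hρ : 0 < ρ) {m : ℕ} {x : Pt d}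
    {γ : Set (Pt d)} : IsSurrounded T ρ m x (γ \ {x}) ↔ IsSurrounded T ρ m x γ := by
  refine isSurrounded_sdiff_singleton fun t ht h => ?_
  rw [Metric.mem_ball, hT.dist_add_smul hρ x ht] at h
  linarith

theorem IsSphereNet.isSurrounded_sdiff_far (hT : IsSphereNet T) (hρ : 0 < ρ) {m : ℕ} {x y : Pt d}
    {γ : Set (Pt d)} (hy : 3 / 2 * ρ ≤ dist x y) :
    IsSurrounded T ρ m x (γ \ {y}) ↔ IsSurrounded T ρ m x γ := by
  refine isSurrounded_sdiff_singleton fun t ht h => ?_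
  have h1 := hT.dist_add_smul hρ x ht
  have h2 := dist_triangle x (x + ρ • t) y
  rw [Metric.mem_ball, dist_comm] at h
  linarith

/-- A single direction suffices: its ball lies within 3ρ/2 of x. -/
theorem IsSphereNet.le_encard_near (hT : IsSphereNet T) (hρ : 0 < ρ) {k : ℕ} {x w : Pt d}
    {γ : Set (Pt d)} (h : IsSurrounded T ρ (k + 1) x γ) :
    (k : ℕ∞) ≤ {p ∈ γ \ {w} | dist w p ≤ dist x w + 3 / 2 * ρ}.encard := by
  obtain ⟨t, ht⟩ := hT.nonempty
  refine (le_encard_sdiff_singleton w (h t ht)).trans (Set.encard_le_encard fun p hp => ?_)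
  refine ⟨⟨hp.1.1, hp.2⟩, ?_⟩
  have h1 := hT.dist_add_smul hρ x ht
  have h2 := dist_triangle4 w x (x + ρ • t) p
  have h3 := Metric.mem_ball'.1 hp.1.2
  have h4 := dist_comm w x
  linarith

/-- Write w = x + s u with a unit vector u and s ≥ ρ, and take t in the net with |u - t| < 1/2. The
path from w through x + ρu and x + ρt to a point of the ball has length less than (s - ρ) + ρ/2 +
ρ/2 = s. -/
theorem IsSphereNet.le_encard_beyond (hT : IsSphereNet T) (hρ : 0 < ρ) {k : ℕ} {x w : Pt d}
    {γ : Set (Pt d)} (h : IsSurrounded T ρ (k + 1) x γ) (hw : ρ ≤ dist x w) :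
    (k : ℕ∞) ≤ {p ∈ γ \ {w} | dist w p < dist w x}.encard := by
  have hr : 0 < ‖w - x‖ := by
    rw [← dist_eq_norm, dist_comm]
    linarith
  set u : Pt d := ‖w - x‖⁻¹ • (w - x) with hu
  have hu1 : ‖u‖ = 1 := by
    rw [hu, norm_smul, norm_inv, norm_norm, inv_mul_cancel₀ hr.ne']
  obtain ⟨t, ht, htu⟩ := hT.exists_dist_lt u hu1
  refine (le_encard_sdiff_singleton w (h t ht)).trans (Set.encard_le_encard fun p hp => ?_)
  refine ⟨⟨hp.1.1, hp.2⟩, ?_⟩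
  have hwu : w = x + ‖w - x‖ • u := by
    rw [hu, smul_smul, mul_inv_cancel₀ hr.ne', one_smul, add_sub_cancel]
  have h1 : dist w (x + ρ • u) = ‖w - x‖ - ρ := by
    conv_lhs => rw [hwu]
    rw [dist_add_left, dist_eq_norm, ← sub_smul, norm_smul, hu1, mul_one, Real.norm_of_nonneg]
    rw [sub_nonneg, ← dist_eq_norm, dist_comm]
    exact hw
  have h2 : dist (x + ρ • u) (x + ρ • t) < ρ / 2 := by
    rw [dist_add_left, dist_smul₀, Real.norm_of_nonneg hρ.le]
    nlinarith
  have h3 := Metric.mem_ball'.1 hp.1.2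
  have h4 := dist_triangle4 w (x + ρ • u) (x + ρ • t) p
  rw [dist_eq_norm w x]
  linarith

/-- The local energy at a surrounded point does not depend on far points. -/
theorem IsSphereNet.localEnergy_sdiff_far (hT : IsSphereNet T) (hρ : 0 < ρ) {Φ : ℝ≥0 → ℝ≥0∞}
    {k : ℕ} {x y : Pt d} {γ : Set (Pt d)} (h : IsSurrounded T ρ (k + 1) x γ)
    (hy : 4 * ρ < dist x y) : localEnergy Φ k x (γ \ {y}) = localEnergy Φ k x γ := by
  classical
  have h' : IsSurrounded T ρ (k + 1) x (γ \ {y}) :=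
    (hT.isSurrounded_sdiff_far hρ (by linarith)).2 h
  have h1 : neighbours k x (γ \ {y}) = neighbours k x γ := by
    refine neighbours_sdiff_singleton (hT.le_encard_near hρ h') ?_
    rw [dist_self]
    linarith
  unfold localEnergy
  rw [h1]
  congr 1
  rw [tsum_subtype (γ \ {y}) fun w => if x ∈ neighbours k w (insert x (γ \ {y})) then
      Φ ‖w - x‖₊ - neighbourPotential Φ k w (γ \ {y}) else 0,
    tsum_subtype γ fun w => if x ∈ neighbours k w (insert x γ) then
      Φ ‖w - x‖₊ - neighbourPotential Φ k w γ else 0]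
  refine tsum_congr fun w => ?_
  by_cases hw : ρ ≤ dist x w
  -- Beyond ρ, x is among the first k neighbours of w neither with y nor without it.
  · have e1 := notMem_neighbours_insert (hT.le_encard_beyond hρ h hw)
    have e2 := notMem_neighbours_insert (hT.le_encard_beyond hρ h' hw)
    simp only [Set.indicator, if_neg e1, if_neg e2, ite_self]
  -- Here w is within ρ of x, so y is at distance more than 3ρ from w, while x and the k-th
  -- neighbour of w are within 5ρ/2 of w.
  · push Not at hw
    have hwy : 3 * ρ < dist w y := by
      have := dist_triangle x w y
      linarith
    have hne : w ≠ y := by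
      rintro rfl
      rw [dist_self] at hwy
      linarith
    have e1 := mem_neighbours_insert_sdiff_singleton (k := k) (γ := γ)
      (show dist w x < dist w y by rw [dist_comm w x]; linarith)
    have e2 := neighbourPotential_sdiff_singleton (Φ := Φ)
      (hT.le_encard_near (w := w) hρ h') (by linarith)
    simp only [Set.indicator, e1, e2, Set.mem_sdiff, Set.mem_singleton_iff, hne, not_false_eq_true,
      and_true]

theorem IsSphereNet.papangelou_sdiff_far (hT : IsSphereNet T) (hρ : 0 < ρ) {Φ : ℝ≥0 → ℝ≥0∞}
    {z β : ℝ} {k : ℕ} {x y : Pt d} {γ : Set (Pt d)} (h : IsSurrounded T ρ (k + 1) x γ)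
    (hy : 4 * ρ < dist x y) : papangelou z β Φ k x (γ \ {y}) = papangelou z β Φ k x γ := by
  rw [papangelou, hT.localEnergy_sdiff_far hρ h hy, papangelou]

end Locality

/-! ### Measurability and translation covariance of being surrounded -/

section Surrounded

variable {d : ℕ} {α : Type*} [MeasurableSpace α] {F : α → Config d}

theorem measurableSet_isSurrounded (hF : Measurable F) (T : Finset (Pt d)) (ρ : ℝ) (m : ℕ)
    {x : α → Pt d} (hx : Measurable x) :
    MeasurableSet {a | IsSurrounded T ρ m (x a) (F a).carrier} := by
  have : {a | IsSurrounded T ρ m (x a) (F a).carrier} = ⋂ t ∈ T,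
      {a | (m : ℕ∞) ≤ {w ∈ (F a).carrier | dist w (x a + ρ • t) < ρ / 2}.encard} := by
    ext a
    simp only [Set.mem_iInter]
    rfl
  rw [this]
  refine Finset.measurableSet_biInter _ fun t _ => ?_
  have h := Config.measurable_encard_sep hF (p := fun a w => dist w (x a + ρ • t) < ρ / 2)
    (measurableSet_lt (measurable_snd.dist ((hx.comp measurable_fst).add_const _))
      measurable_const)
  exact h (MeasurableSpace.measurableSet_top (s := Set.Ici (m : ℕ∞)))

theorem isSurrounded_shift {T : Finset (Pt d)} {ρ : ℝ} {m : ℕ} {x u : Pt d} {γ : Config d} :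
    IsSurrounded T ρ m (x + u) (γ.shift u).carrier ↔ IsSurrounded T ρ m x γ.carrier := by
  refine forall₂_congr fun t _ => ?_
  have : (γ.shift u).carrier ∩ Metric.ball (x + u + ρ • t) (ρ / 2) =
      (fun w => w + u) '' (γ.carrier ∩ Metric.ball (x + ρ • t) (ρ / 2)) := by
    rw [Set.image_inter (add_left_injective u), add_right_comm]
    simp [Config.shift]
  rw [this, (add_left_injective u).encard_image]

end Surrounded

/-! ### Stationarity, infinitely many points, and existence of surrounded points -/

section Stationary

variable {d : ℕ} {P : Measure (Config d)}

theorem Config.tsum_shift (γ : Config d) (u : Pt d) (f : Pt d → ℝ≥0∞) :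
    ∑' x : (γ.shift u).carrier, f x.1 = ∑' x : γ.carrier, f (x.1 + u) := by
  exact ((Equiv.Set.image (fun x => x + u) γ.carrier (add_left_injective u)).tsum_eq
    (fun x : (γ.shift u).carrier => f x.1)).symm

theorem measurable_tsum_indicator {B : Set (Pt d)} (hB : MeasurableSet B)
    {F : Pt d → Config d → ℝ≥0∞} (hF : Measurable (Function.uncurry F)) :
    Measurable fun γ : Config d => ∑' x : γ.carrier, B.indicator 1 x.1 * F x.1 γ :=
  Config.measurable_tsum measurable_id (f := fun γ x => B.indicator 1 x * F x γ) <|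
    ((measurable_one.indicator hB).comp measurable_snd).mul (hF.comp measurable_swap)

/-- Campbell's formula: the mean number of points in `B`, counted with a translation-covariant
weight, is proportional to the volume of `B`. -/
theorem IsStationaryProcess.exists_lintegral_tsum_eq [SFinite P] (hP : IsStationaryProcess P)
    {F : Pt d → Config d → ℝ≥0∞} (hF : Measurable (Function.uncurry F))
    (hFs : ∀ u x γ, F (x + u) (γ.shift u) = F x γ)
    (hfin : ∀ K : Set (Pt d), Bornology.IsBounded K → MeasurableSet K →
      ∫⁻ γ, ∑' x : γ.carrier, K.indicator 1 x.1 * F x.1 γ ∂P < ∞) :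
    ∃ c : ℝ≥0, ∀ B : Set (Pt d), MeasurableSet B →
      ∫⁻ γ, ∑' x : γ.carrier, B.indicator 1 x.1 * F x.1 γ ∂P = c * volume B := by
  let ν : Measure (Pt d) := ((P ⊗ₘ Config.countingKernel d).withDensity
    fun p => F p.2 p.1).map Prod.snd
  have hF' : Measurable fun p : Config d × Pt d => F p.2 p.1 := hF.comp measurable_swap
  have hν : ∀ B, MeasurableSet B →
      ν B = ∫⁻ γ, ∑' x : γ.carrier, B.indicator 1 x.1 * F x.1 γ ∂P := by
    intro B hB
    rw [Measure.map_apply measurable_snd hB, withDensity_apply _ (measurable_snd hB),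
      ← lintegral_indicator (measurable_snd hB),
      Measure.lintegral_compProd (hF'.indicator (measurable_snd hB))]
    refine lintegral_congr fun γ => ?_
    rw [Config.countingKernel_apply, Config.lintegral_counting]
    refine tsum_congr fun x => ?_
    by_cases hx : x.1 ∈ B <;> simp [hx]
  have : IsFiniteMeasureOnCompacts ν := ⟨fun K hK => by
    rw [hν K hK.measurableSet]
    exact hfin K hK.isBounded hK.measurableSet⟩
  -- Invariance of `P` and covariance of `F` make the mean measure translation invariant; being
  -- locally finite, it is then a multiple of Lebesgue measure.
  have : ν.IsAddLeftInvariant := ⟨fun u => by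
    ext B hB
    have hu : Measurable fun x : Pt d => u + x := measurable_const_add u
    rw [Measure.map_apply hu hB, hν _ (hu hB), hν B hB,
      ← (hP u).lintegral_comp (measurable_tsum_indicator hB hF)]
    refine lintegral_congr fun γ => ?_
    rw [Config.tsum_shift γ u fun x => B.indicator 1 x * F x (γ.shift u)]
    refine tsum_congr fun x => ?_
    rw [hFs, add_comm x.1 u]
    rfl⟩
  refine ⟨ν.addHaarScalarFactor volume, fun B hB => ?_⟩
  rw [← hν B hB]
  conv_lhs => rw [Measure.isAddLeftInvariant_eq_smul ν volume]
  rfl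

theorem Config.tsum_indicator (γ : Config d) (B : Set (Pt d)) :
    ∑' x : γ.carrier, B.indicator (1 : Pt d → ℝ≥0∞) x.1 = ((γ.carrier ∩ B).encard : ℝ≥0∞) := by
  classical
  rw [show γ.carrier ∩ B = {x ∈ γ.carrier | x ∈ B} from rfl, Config.encard_sep_eq_tsum]
  refine tsum_congr fun x => ?_
  by_cases hx : x.1 ∈ B <;> simp [hx]

theorem volume_univ_eq_top (hd : 1 ≤ d) : volume (Set.univ : Set (Pt d)) = ∞ := by
  have : Nonempty (Fin d) := ⟨⟨0, hd⟩⟩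
  exact measure_univ_of_isAddLeftInvariant _

theorem measurableSet_encard_le (m : ℕ) {B : Set (Pt d)} (hB : MeasurableSet B) :
    MeasurableSet {γ : Config d | (γ.carrier ∩ B).encard ≤ m} :=
  Config.measurable_encard_inter hB
    (MeasurableSpace.measurableSet_top (s := Set.Iic (m : ℕ∞)))

/-- A stationary process has either no point or infinitely many. -/
theorem IsStationaryProcess.measure_encard_le_of_nonempty (hd : 1 ≤ d) [IsProbabilityMeasure P]
    (hP : IsStationaryProcess P) (m : ℕ) :
    P {γ | γ.carrier.encard ≤ m ∧ γ.carrier.Nonempty} = 0 := by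
  classical
  let A : Set (Config d) := {γ | γ.carrier.encard ≤ m}
  have hA : MeasurableSet A := by
    have := measurableSet_encard_le (d := d) m MeasurableSet.univ
    simp only [Set.inter_univ] at this
    exact this
  let F : Pt d → Config d → ℝ≥0∞ := fun _ γ => A.indicator 1 γ
  have hF : Measurable (Function.uncurry F) := (measurable_one.indicator hA).comp measurable_snd
  have hbound : ∀ B : Set (Pt d),
      ∫⁻ γ, ∑' x : γ.carrier, B.indicator 1 x.1 * F x.1 γ ∂P ≤ m := by
    intro B
    calc _ ≤ ∫⁻ γ, (m : ℝ≥0∞) ∂P := by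
          refine lintegral_mono fun γ => ?_
          simp only [F]
          rw [ENNReal.tsum_mul_right, Config.tsum_indicator]
          by_cases hγ : γ ∈ A
          · have : (γ.carrier ∩ B).encard ≤ (m : ℕ∞) :=
              (Set.encard_le_encard Set.inter_subset_left).trans hγ
            simpa [hγ] using ENat.toENNReal_le.2 this
          · simp [hγ]
      _ = m := by simp
  obtain ⟨c, hc⟩ := hP.exists_lintegral_tsum_eq hF (fun u x γ => by
    have : γ.shift u ∈ A ↔ γ ∈ A := by
      simp only [A, Config.shift, Set.mem_ofPred_eq, (add_left_injective u).encard_image]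
    simp only [F, Set.indicator, this, Pi.one_apply]) fun K _ _ => (hbound K).trans_lt (by simp)
  have h1 : (c : ℝ≥0∞) * volume (Set.univ : Set (Pt d)) ≤ m :=
    (hc _ MeasurableSet.univ).symm.trans_le (hbound _)
  -- The mean measure has total mass at most m, whereas a nonzero multiple of Lebesgue measure has
  -- infinite mass.
  have hc0 : c = 0 := by
    by_contra hc0
    rw [volume_univ_eq_top hd, ENNReal.mul_top (by simpa using hc0)] at h1
    simp at h1
  have h2 := hc Set.univ MeasurableSet.univ
  rw [hc0, ENNReal.coe_zero, zero_mul,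
    lintegral_eq_zero_iff (measurable_tsum_indicator MeasurableSet.univ hF)] at h2
  rw [measure_eq_zero_iff_ae_notMem]
  filter_upwards [h2] with γ hγ ⟨h3, x, hx⟩
  have h4 := ENNReal.tsum_eq_zero.1 hγ ⟨x, hx⟩
  have : γ ∈ A := h3
  simp [F, this] at h4

/-- An erasure leaves the empty configuration only if γ had at most that one point. -/
theorem tsum_erase_eq_empty_le_one (γ : Config d) :
    ∑' x : γ.carrier, {γ : Config d | γ.carrier = ∅}.indicator (1 : Config d → ℝ≥0∞)
      (γ.erase x.1) ≤ 1 := by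
  by_cases h : ∃ x : γ.carrier, (γ.erase x.1).carrier = ∅
  · obtain ⟨x, hx⟩ := h
    rw [tsum_eq_single x]
    · exact Set.indicator_apply_le' (fun _ => le_rfl) fun _ => zero_le
    · intro y hy
      exfalso
      refine Set.eq_empty_iff_forall_notMem.1 hx y.1 ⟨y.2, fun h => hy (Subtype.ext h)⟩
  · have h' : ∀ x : γ.carrier, {γ : Config d | γ.carrier = ∅}.indicator (1 : Config d → ℝ≥0∞)
        (γ.erase x.1) = 0 := fun x => by
      rw [Set.indicator_of_notMem]
      exact fun hx => h ⟨x, hx⟩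
    simp [h']

/-- Test the GNZ equation with the indicator of emptiness: the sum over points is at most 1, but the
integral over space is infinite on the empty configuration. -/
theorem IsGibbs.measure_empty (hd : 1 ≤ d) [IsFiniteMeasure P] {lam : Pt d → Set (Pt d) → ℝ≥0∞}
    (hG : IsGibbs lam P) {c : ℝ≥0∞} (hc : c ≠ 0) (hlam : ∀ x, lam x ∅ = c) :
    P {γ | γ.carrier = ∅} = 0 := by
  have hA : MeasurableSet {γ : Config d | γ.carrier = ∅} := by
    simpa using measurableSet_encard_le (d := d) 0 MeasurableSet.univ
  by_contra h0
  have h := hG (fun q => {γ : Config d | γ.carrier = ∅}.indicator 1 q.2)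
    ((measurable_one.indicator hA).comp measurable_snd)
  have h1 : ∫⁻ γ : Config d, ∫⁻ x : Pt d, {γ : Config d | γ.carrier = ∅}.indicator 1 γ *
      lam x γ.carrier ∂volume ∂P = ∞ := by
    calc _ = ∫⁻ γ : Config d, {γ : Config d | γ.carrier = ∅}.indicator (fun _ => ∞) γ ∂P := by
          refine lintegral_congr fun γ => ?_
          by_cases hγ : γ.carrier = ∅
          · simp [hγ, hlam, volume_univ_eq_top hd, ENNReal.mul_top hc]
          · simp [hγ]
      _ = ∞ := by
          rw [lintegral_indicator hA, lintegral_const, Measure.restrict_apply_univ,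
            ENNReal.top_mul h0]
  have h2 : ∫⁻ γ : Config d, ∑' x : γ.carrier, {γ : Config d | γ.carrier = ∅}.indicator
      (1 : Config d → ℝ≥0∞) (γ.erase x.1) ∂P ≤ P Set.univ :=
    (lintegral_mono tsum_erase_eq_empty_le_one).trans (by simp)
  exact absurd (h1 ▸ h ▸ h2) (not_le.2 (measure_lt_top P _))

theorem exists_measure_encard_ball_le_lt [IsFiniteMeasure P]
    {m : ℕ} (h : P {γ | γ.carrier.encard ≤ m} = 0) {ε : ℝ≥0∞} (hε : 0 < ε) :
    ∃ r : ℝ, 0 < r ∧ P {γ | (γ.carrier ∩ Metric.ball 0 r).encard ≤ m} < ε := by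
  let s : ℕ → Set (Config d) := fun n => {γ | (γ.carrier ∩ Metric.ball 0 (n + 1)).encard ≤ m}
  have hs : Antitone s := fun a b hab γ hγ => by
    refine le_trans (Set.encard_le_encard (Set.inter_subset_inter_right _
      (Metric.ball_subset_ball ?_))) hγ
    exact_mod_cast Nat.succ_le_succ hab
  have hlim := tendsto_measure_iInter_atTop (μ := P) (s := s)
    (fun n => (measurableSet_encard_le m measurableSet_ball).nullMeasurableSet) hs
    ⟨0, measure_ne_top _ _⟩
  have h0 : P (⋂ n, s n) = 0 := by
    refine measure_mono_null (fun γ hγ => ?_) h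
    by_contra hcon
    have hcon' : ((m + 1 : ℕ) : ℕ∞) ≤ γ.carrier.encard := by
      push_cast
      exact Order.add_one_le_of_lt (not_le.1 hcon)
    obtain ⟨t, ht, htc⟩ := Set.exists_subset_encard_eq hcon'
    have hfin : t.Finite := Set.finite_of_encard_eq_coe htc
    obtain ⟨r, hr⟩ := hfin.isBounded.subset_ball (0 : Pt d)
    obtain ⟨n, hn⟩ := exists_nat_ge r
    have h1 := Set.mem_iInter.1 hγ n
    have h2 : t ⊆ γ.carrier ∩ Metric.ball 0 (n + 1) := fun x hx =>
      ⟨ht hx, Metric.ball_subset_ball (by linarith) (hr hx)⟩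
    have h3 : ((m + 1 : ℕ) : ℕ∞) ≤ m := htc ▸ (Set.encard_le_encard h2).trans h1
    have h4 : m + 1 ≤ m := by exact_mod_cast h3
    omega
  rw [h0] at hlim
  obtain ⟨n, hn⟩ := (hlim.eventually (gt_mem_nhds hε)).exists
  exact ⟨n + 1, by positivity, hn⟩

theorem IsStationaryProcess.measure_encard_ball_le (hP : IsStationaryProcess P) (m : ℕ) (r : ℝ)
    (u : Pt d) : P {γ | (γ.carrier ∩ Metric.ball u r).encard ≤ m} =
      P {γ | (γ.carrier ∩ Metric.ball 0 r).encard ≤ m} := by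
  rw [← (hP u).measure_preimage (measurableSet_encard_le m measurableSet_ball).nullMeasurableSet]
  congr 1
  ext γ
  have : (γ.shift u).carrier ∩ Metric.ball u r =
      (fun w => w + u) '' (γ.carrier ∩ Metric.ball 0 r) := by
    rw [Set.image_inter (add_left_injective u)]
    simp [Config.shift]
  simp only [Set.mem_preimage, Set.mem_ofPred_eq, this, (add_left_injective u).encard_image]

open scoped Classical in
/-- The indicator function of the event that `x` is surrounded by points of `γ`. -/
noncomputable def surroundedIndicator (T : Finset (Pt d)) (ρ : ℝ) (m : ℕ) (x : Pt d)
    (γ : Config d) : ℝ≥0∞ := if IsSurrounded T ρ m x γ.carrier then 1 else 0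

theorem measurable_surroundedIndicator (T : Finset (Pt d)) (ρ : ℝ) (m : ℕ) :
    Measurable (Function.uncurry (surroundedIndicator T ρ m)) :=
  Measurable.ite (measurableSet_isSurrounded measurable_snd T ρ m measurable_fst)
    measurable_const measurable_const

theorem surroundedIndicator_le_one (T : Finset (Pt d)) (ρ : ℝ) (m : ℕ) (x : Pt d)
    (γ : Config d) : surroundedIndicator T ρ m x γ ≤ 1 := by
  unfold surroundedIndicator
  split_ifs <;> simp

/-- If `P` almost surely has infinitely many points, then at a large scale there are surrounded
points with positive probability. -/
theorem IsStationaryProcess.exists_lintegral_surrounded_pos [IsProbabilityMeasure P]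
    (hP : IsStationaryProcess P) (hinf : ∀ m : ℕ, P {γ | γ.carrier.encard ≤ m} = 0)
    (T : Finset (Pt d)) (k : ℕ) :
    ∃ ρ : ℝ, 0 < ρ ∧ ∃ q : ℝ, ∫⁻ γ, ∑' x : γ.carrier,
      (Metric.ball 0 q).indicator 1 x.1 * surroundedIndicator T ρ (k + 1) x.1 γ ∂P ≠ 0 := by
  -- There are |T| + 1 bad events, one for the ball at the origin and one per direction. With this ε
  -- their probabilities add up to less than 1.
  have hε : (0 : ℝ≥0∞) < ((T.card + 2 : ℕ) : ℝ≥0∞)⁻¹ := by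
    rw [ENNReal.inv_pos]
    exact ENNReal.natCast_ne_top _
  set ε : ℝ≥0∞ := ((T.card + 2 : ℕ) : ℝ≥0∞)⁻¹ with hεdef
  obtain ⟨q, hq, hqε⟩ := exists_measure_encard_ball_le_lt (hinf 0) hε
  obtain ⟨r, hr, hrε⟩ := exists_measure_encard_ball_le_lt (hinf k) hε
  -- With ρ/2 = r + q, the ball of radius r at ρt lies in the ball of radius ρ/2 at x + ρt for every
  -- x of norm less than q.
  have hρ : 0 < 2 * (r + q) := by positivity
  refine ⟨2 * (r + q), hρ, q, fun h0 => ?_⟩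
  set ρ := 2 * (r + q) with hρdef
  have hmeas := measurable_tsum_indicator (measurableSet_ball (x := (0 : Pt d)) (ε := q))
    (measurable_surroundedIndicator T ρ (k + 1))
  rw [lintegral_eq_zero_iff hmeas] at h0
  have hnull : P {γ | ∑' x : γ.carrier, (Metric.ball 0 q).indicator 1 x.1 *
      surroundedIndicator T ρ (k + 1) x.1 γ ≠ 0} = 0 := h0
  have hcover : (Set.univ : Set (Config d)) ⊆
      ({γ | ∑' x : γ.carrier, (Metric.ball 0 q).indicator 1 x.1 *
        surroundedIndicator T ρ (k + 1) x.1 γ ≠ 0} ∪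
      {γ | (γ.carrier ∩ Metric.ball 0 q).encard ≤ (0 : ℕ)}) ∪
      ⋃ t ∈ T, {γ | (γ.carrier ∩ Metric.ball (ρ • t) r).encard ≤ k} := by
    intro γ _
    by_contra hγ
    simp only [Set.mem_union, Set.mem_iUnion, exists_prop, not_or, not_exists, not_and,
      Set.mem_ofPred_eq, not_le, not_ne_iff, Nat.cast_zero, pos_iff_ne_zero,
      Set.encard_ne_zero] at hγ
    obtain ⟨⟨h1, x, hx, hxq⟩, h2⟩ := hγ
    have h3 := ENNReal.tsum_eq_zero.1 h1 ⟨x, hx⟩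
    have h4 : IsSurrounded T ρ (k + 1) x γ.carrier := by
      intro t ht
      have h5 : ((k + 1 : ℕ) : ℕ∞) ≤ (γ.carrier ∩ Metric.ball (ρ • t) r).encard := by
        push_cast
        exact Order.add_one_le_of_lt (h2 t ht)
      refine h5.trans (Set.encard_le_encard (Set.inter_subset_inter_right _
        (Metric.ball_subset_ball' ?_)))
      rw [dist_comm, dist_add_self_left, hρdef]
      have := mem_ball_zero_iff.1 hxq
      linarith
    simp [hxq, surroundedIndicator, h4] at h3
  have h1 : (1 : ℝ≥0∞) ≤ 0 + ε + ∑ t ∈ T, ε := by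
    calc (1 : ℝ≥0∞) = P Set.univ := by simp
      _ ≤ _ := measure_mono hcover
      _ ≤ _ := (measure_union_le _ _).trans (add_le_add ((measure_union_le _ _).trans
          (add_le_add hnull.le hqε.le)) ((measure_biUnion_finset_le _ _).trans
          (Finset.sum_le_sum fun t _ => (hP.measure_encard_ball_le k r (ρ • t)).trans_le hrε.le)))
  have h2 : (0 : ℝ≥0∞) + ε + ∑ t ∈ T, ε = ((T.card + 1 : ℕ) : ℝ≥0∞) / ((T.card + 2 : ℕ) : ℝ≥0∞) := by
    rw [Finset.sum_const, nsmul_eq_mul, zero_add, div_eq_mul_inv, ← hεdef]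
    push_cast
    ring
  rw [h2, ENNReal.le_div_iff_mul_le (by simp) (by simp), one_mul] at h1
  have h3 : T.card + 2 ≤ T.card + 1 := by exact_mod_cast h1
  omega

end Stationary

/-! ### Variance bound from mixed moments -/

/-- Integrate (N - m - t(S - A))² ≥ 0, a parametrised Cauchy–Schwarz inequality for N and the
centred variable S - A. Negative terms are moved across so that all integrals are taken in `ℝ≥0∞`,
and N need not be square integrable. -/
theorem evariance_ge_of_moments {Ω : Type*} [MeasurableSpace Ω] {P : Measure Ω} {X : Ω → ℝ}
    {N S A : Ω → ℝ≥0∞} (hN : Measurable N) (hS : Measurable S) (hA : Measurable A)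
    (hX : ∀ ω, X ω = (N ω).toReal) (hNf : ∀ ω, N ω ≠ ∞) (hSf : ∀ ω, S ω ≠ ∞)
    (hAf : ∀ ω, A ω ≠ ∞) {D E : ℝ≥0∞} (hSA : ∫⁻ ω, S ω ∂P = ∫⁻ ω, A ω ∂P)
    (hNS : ∫⁻ ω, N ω * S ω ∂P = ∫⁻ ω, N ω * A ω ∂P + ∫⁻ ω, A ω ∂P)
    (hD : D ≤ ∫⁻ ω, S ω * A ω ∂P)
    (hE : ∫⁻ ω, S ω * S ω ∂P + ∫⁻ ω, A ω * A ω ∂P ≤ 2 * D + E)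
    (hDf : D ≠ ∞) (hNAf : ∫⁻ ω, N ω * A ω ∂P ≠ ∞) (hIAf : ∫⁻ ω, A ω ∂P ≠ ∞) (t : ℝ≥0) :
    2 * t * ∫⁻ ω, A ω ∂P ≤ evariance X P + t ^ 2 * E := by
  have hm0 : 0 ≤ ∫ ω, X ω ∂P := integral_nonneg fun ω => by
    rw [hX]
    exact ENNReal.toReal_nonneg
  obtain ⟨m, hm⟩ : ∃ m : ℝ≥0, (m : ℝ) = ∫ ω, X ω ∂P := ⟨⟨_, hm0⟩, rfl⟩
  have hpt : ∀ ω, 2 * t * (N ω * S ω) + 2 * t * m * A ω + 2 * t ^ 2 * (S ω * A ω) ≤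
      ‖X ω - ∫ ω, X ω ∂P‖ₑ ^ 2 + (2 * t * (N ω * A ω) + 2 * t * m * S ω +
        t ^ 2 * (S ω * S ω + A ω * A ω)) := by
    intro ω
    rw [hX ω, ← hm]
    lift N ω to ℝ≥0 using hNf ω with n
    lift S ω to ℝ≥0 using hSf ω with s
    lift A ω to ℝ≥0 using hAf ω with a
    rw [enorm_eq_nnnorm]
    have hv : ((‖(n : ℝ) - m‖₊ : ℝ≥0) : ℝ) ^ 2 = ((n : ℝ) - m) ^ 2 := by
      rw [coe_nnnorm, Real.norm_eq_abs, sq_abs]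
    simp only [ENNReal.coe_toReal]
    generalize ‖(n : ℝ) - m‖₊ = v at hv
    norm_cast
    rw [← NNReal.coe_le_coe]
    push_cast
    rw [hv]
    nlinarith [sq_nonneg ((n : ℝ) - m - t * (s - a))]
  have hint := lintegral_mono (μ := P) hpt
  rw [lintegral_add_right _ (by fun_prop), lintegral_add_right _ (by fun_prop),
    lintegral_add_right _ (by fun_prop), lintegral_add_right _ (by fun_prop),
    lintegral_add_right _ (by fun_prop), lintegral_const_mul _ (by fun_prop),
    lintegral_const_mul _ (by fun_prop), lintegral_const_mul _ (by fun_prop),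
    lintegral_const_mul _ (by fun_prop), lintegral_const_mul _ (by fun_prop),
    lintegral_const_mul _ (by fun_prop), lintegral_add_right _ (by fun_prop), hNS, hSA] at hint
  change _ ≤ evariance X P + _ at hint
  set IA := ∫⁻ ω, A ω ∂P
  set INA := ∫⁻ ω, N ω * A ω ∂P
  -- These terms occur on both sides and must be finite to be cancelled.
  have hX' : 2 * t * INA + 2 * t * m * IA + 2 * t ^ 2 * D ≠ ∞ := by finiteness
  refine (ENNReal.add_le_add_iff_left hX').1 ?_
  calc 2 * t * INA + 2 * t * m * IA + 2 * t ^ 2 * D + 2 * t * IA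
      = 2 * t * (INA + IA) + 2 * t * m * IA + 2 * t ^ 2 * D := by ring
    _ ≤ 2 * t * (INA + IA) + 2 * t * m * IA + 2 * t ^ 2 * ∫⁻ ω, S ω * A ω ∂P := by gcongr
    _ ≤ _ := hint
    _ ≤ evariance X P + (2 * t * INA + 2 * t * m * IA + t ^ 2 * (2 * D + E)) := by gcongr
    _ = _ := by ring

/-! ### Weighted sums over points and their compensators -/

section Innovation

variable {d : ℕ} {P : Measure (Config d)} {lam : Pt d → Set (Pt d) → ℝ≥0∞}

theorem Config.tsum_eq_tsum_indicator (γ : Config d) (f : Pt d → ℝ≥0∞) :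
    ∑' x : γ.carrier, f x.1 = ∑' x, γ.carrier.indicator f x := tsum_subtype _ _

theorem Config.tsum_erase (γ : Config d) {x : Pt d} {f : Pt d → ℝ≥0∞} (hf : f x = 0) :
    ∑' y : (γ.erase x).carrier, f y.1 = ∑' y : γ.carrier, f y.1 := by
  rw [Config.tsum_eq_tsum_indicator, Config.tsum_eq_tsum_indicator]
  refine tsum_congr fun y => ?_
  by_cases hy : y = x
  · subst hy
    simp [Config.erase, Set.indicator, hf]
  · by_cases hγ : y ∈ γ.carrier <;> simp [Config.erase, hy, hγ]

theorem Config.tsum_eq_add_tsum_erase (γ : Config d) {x : Pt d} (hx : x ∈ γ.carrier)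
    (f : Pt d → ℝ≥0∞) :
    ∑' y : γ.carrier, f y.1 = f x + ∑' y : (γ.erase x).carrier, f y.1 := by
  classical
  rw [Config.tsum_eq_tsum_indicator, Config.tsum_eq_tsum_indicator,
    ENNReal.tsum_eq_add_tsum_ite x, Set.indicator_of_mem hx]
  congr 1
  refine tsum_congr fun y => ?_
  by_cases hy : y = x
  · simp [Config.erase, hy]
  · by_cases hγ : y ∈ γ.carrier <;> simp [Config.erase, hy, hγ]

theorem Config.erase_comm (γ : Config d) (x y : Pt d) :
    (γ.erase x).erase y = (γ.erase y).erase x := by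
  ext z
  simp [Config.erase]
  tauto

theorem IsGibbs.lintegral_tsum_indicator (hG : IsGibbs lam P) {Λ : Set (Pt d)}
    (hΛ : MeasurableSet Λ) {f : Pt d → Config d → ℝ≥0∞} (hf : Measurable (Function.uncurry f)) :
    ∫⁻ γ, ∑' x : γ.carrier, Λ.indicator 1 x.1 * f x.1 (γ.erase x.1) ∂P =
      ∫⁻ γ, ∫⁻ x in Λ, f x γ * lam x γ.carrier ∂volume ∂P := by
  rw [hG (fun q => Λ.indicator 1 q.1 * f q.1 q.2)
    (((measurable_one.indicator hΛ).comp measurable_fst).mul hf)]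
  refine lintegral_congr fun γ => ?_
  rw [← lintegral_indicator hΛ]
  refine lintegral_congr fun x => ?_
  by_cases hx : x ∈ Λ <;> simp [hx]

/-- The number of points in `Λ`. -/
noncomputable def Config.number (Λ : Set (Pt d)) (γ : Config d) : ℝ≥0∞ :=
  ∑' x : γ.carrier, Λ.indicator 1 x.1

theorem Config.measurable_number {Λ : Set (Pt d)} (hΛ : MeasurableSet Λ) :
    Measurable (Config.number (d := d) Λ) :=
  Config.measurable_tsum measurable_id (f := fun _ x => Λ.indicator 1 x)
    ((measurable_one.indicator hΛ).comp measurable_snd)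

theorem IsGibbs.lintegral_number_le (hG : IsGibbs lam P) [IsProbabilityMeasure P] {z : ℝ≥0}
    (hz : ∀ x γ, lam x γ ≤ z) {Λ : Set (Pt d)} (hΛ : MeasurableSet Λ) :
    ∫⁻ γ, Config.number Λ γ ∂P ≤ z * volume Λ := by
  have h := hG.lintegral_tsum_indicator hΛ (f := fun _ _ => 1) measurable_const
  simp only [mul_one, one_mul] at h
  refine h.trans_le ?_
  calc _ ≤ ∫⁻ γ : Config d, z * volume Λ ∂P := by
        refine lintegral_mono fun γ => ?_
        calc _ ≤ ∫⁻ x in Λ, (z : ℝ≥0∞) ∂volume := lintegral_mono fun x => hz _ _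
          _ = _ := by simp
    _ = _ := by simp

/-- The sum of a local weight over the points in `Λ`. -/
noncomputable def weightSum (g : Pt d → Config d → ℝ≥0∞) (Λ : Set (Pt d)) (γ : Config d) : ℝ≥0∞ :=
  ∑' x : γ.carrier, Λ.indicator 1 x.1 * g x.1 (γ.erase x.1)

/-- The compensator of `weightSum`. -/
noncomputable def compensator (a : Pt d → Config d → ℝ≥0∞) (Λ : Set (Pt d)) (γ : Config d) :
    ℝ≥0∞ := ∫⁻ x in Λ, a x γ

variable {g : Pt d → Config d → ℝ≥0∞} {Λ : Set (Pt d)}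

theorem weightSum_le_add_number (hg1 : ∀ x γ, g x γ ≤ 1) (Λ' : Set (Pt d)) (γ : Config d) :
    weightSum g Λ γ ≤ weightSum g (Λ \ Λ') γ + Config.number Λ' γ := by
  rw [weightSum, weightSum, Config.number, ← ENNReal.tsum_add]
  refine ENNReal.tsum_le_tsum fun x => ?_
  by_cases hx : x.1 ∈ Λ <;> by_cases hx' : x.1 ∈ Λ' <;> simp [hx, hx', hg1]

theorem weightSum_le_number (hg1 : ∀ x γ, g x γ ≤ 1) (γ : Config d) :
    weightSum g Λ γ ≤ Config.number Λ γ := by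
  refine ENNReal.tsum_le_tsum fun x => ?_
  exact mul_le_of_le_one_right' (hg1 _ _)

theorem measurable_weightSum {α : Type*} [MeasurableSpace α]
    (hg : Measurable (Function.uncurry g)) {L : α → Set (Pt d)}
    (hL : MeasurableSet {q : α × Pt d | q.2 ∈ L q.1}) {F : α → Config d} (hF : Measurable F) :
    Measurable fun a => weightSum g (L a) (F a) := by
  refine Config.measurable_tsum hF (f := fun a x =>
    (L a).indicator 1 x * g x ((F a).erase x)) ?_
  refine Measurable.mul (f := fun q : α × Pt d => (L q.1).indicator 1 q.2)
    ((measurable_one (α := ℝ≥0∞)).indicator hL) ?_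
  exact hg.comp (measurable_snd.prodMk
    (Config.measurable_erase (hF.comp measurable_fst) measurable_snd))

theorem measurable_compensator {α : Type*} [MeasurableSpace α] {a : Pt d → Config d → ℝ≥0∞}
    (ha : Measurable (Function.uncurry a)) {L : α → Set (Pt d)}
    (hL : MeasurableSet {q : α × Pt d | q.2 ∈ L q.1}) {F : α → Config d} (hF : Measurable F) :
    Measurable fun b => compensator a (L b) (F b) := by
  have hLb : ∀ b, MeasurableSet (L b) := fun b => measurable_prodMk_left hL
  simp only [compensator, ← lintegral_indicator (hLb _)]
  refine Measurable.lintegral_prod_right' (f := fun q : α × Pt d =>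
    (L q.1).indicator (fun x => a x (F q.1)) q.2) ?_
  exact (ha.comp (measurable_snd.prodMk (hF.comp measurable_fst))).indicator hL

end Innovation

/-! ### Second moments of the innovation and the variance bound -/

section Variance

variable {d : ℕ} {P : Measure (Config d)} {lam : Pt d → Set (Pt d) → ℝ≥0∞}

theorem Config.countable_carrier (γ : Config d) : γ.carrier.Countable := by
  have : γ.carrier = ⋃ n : ℕ, γ.carrier ∩ Metric.ball 0 n := by
    rw [← Set.inter_iUnion, Metric.iUnion_ball_nat, Set.inter_univ]
  rw [this]
  exact Set.countable_iUnion fun n => (γ.locallyFinite _ Metric.isBounded_ball).countable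

/-- A bounded weight such that both the weight and its product with the Papangelou intensity
depend only on the points up to the distance `R`. -/
structure IsLocalWeight (lam : Pt d → Set (Pt d) → ℝ≥0∞) (R : ℝ)
    (g : Pt d → Config d → ℝ≥0∞) : Prop where
  measurable : Measurable (Function.uncurry g)
  le_one : ∀ x γ, g x γ ≤ 1
  erase_far : ∀ x y γ, R < dist x y → g x (γ.erase y) = g x γ
  mul_erase_far : ∀ x y γ, R < dist x y →
    g x (γ.erase y) * lam x (γ.erase y).carrier = g x γ * lam x γ.carrier

/-- The density of the compensator of a weighted sum. -/
noncomputable def weightDensity (lam : Pt d → Set (Pt d) → ℝ≥0∞) (g : Pt d → Config d → ℝ≥0∞)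
    (x : Pt d) (γ : Config d) : ℝ≥0∞ := g x γ * lam x γ.carrier

variable {g : Pt d → Config d → ℝ≥0∞} {Λ : Set (Pt d)} {R : ℝ} {z : ℝ≥0}

theorem IsLocalWeight.measurable_density (hg : IsLocalWeight lam R g)
    (hlam : Measurable fun q : Pt d × Config d => lam q.1 q.2.carrier) :
    Measurable (Function.uncurry (weightDensity lam g)) := hg.measurable.mul hlam

theorem IsLocalWeight.density_le (hg : IsLocalWeight lam R g) (hz : ∀ x γ, lam x γ ≤ z) (x : Pt d)
    (γ : Config d) : weightDensity lam g x γ ≤ z :=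
  (mul_le_of_le_one_left' (hg.le_one x γ)).trans (hz _ _)

theorem IsLocalWeight.weightSum_far_erase (hg : IsLocalWeight lam R g) (hR : 0 ≤ R) (x : Pt d)
    (γ : Config d) : weightSum g (Λ \ Metric.closedBall x R) (γ.erase x) =
      weightSum g (Λ \ Metric.closedBall x R) γ := by
  unfold weightSum
  rw [← Config.tsum_erase γ (x := x)
    (f := fun y => (Λ \ Metric.closedBall x R).indicator 1 y * g y (γ.erase y)) (by simp [hR])]
  refine tsum_congr fun y => ?_
  by_cases hy : y.1 ∈ Λ \ Metric.closedBall x R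
  · rw [Config.erase_comm, hg.erase_far y.1 x _ (by simpa using hy.2)]
  · simp [Set.indicator_of_notMem hy]

theorem IsLocalWeight.compensator_far_erase (hg : IsLocalWeight lam R g) (hΛ : MeasurableSet Λ)
    (x : Pt d) (γ : Config d) :
    compensator (weightDensity lam g) (Λ \ Metric.closedBall x R) (γ.erase x) =
      compensator (weightDensity lam g) (Λ \ Metric.closedBall x R) γ :=
  setLIntegral_congr_fun (hΛ.diff measurableSet_closedBall) fun y hy =>
    hg.mul_erase_far y x γ (by simpa using hy.2)

theorem compensator_le {a : Pt d → Config d → ℝ≥0∞} (ha : ∀ x γ, a x γ ≤ z) (Λ : Set (Pt d))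
    (γ : Config d) : compensator a Λ γ ≤ z * volume Λ := by
  calc compensator a Λ γ ≤ ∫⁻ x in Λ, (z : ℝ≥0∞) := lintegral_mono fun x => ha _ _
    _ = _ := by simp

theorem lintegral_le_of_forall_le [IsProbabilityMeasure P] {f : Config d → ℝ≥0∞} {c : ℝ≥0∞}
    (h : ∀ γ, f γ ≤ c) : ∫⁻ γ, f γ ∂P ≤ c :=
  (lintegral_mono h).trans (by simp)

theorem measurableSet_mem_far (hΛ : MeasurableSet Λ) :
    MeasurableSet {q : (Pt d × Config d) × Pt d | q.2 ∈ Λ \ Metric.closedBall q.1.1 R} :=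
  (measurable_snd hΛ).diff
    (measurableSet_le (measurable_snd.dist (measurable_fst.comp measurable_fst)) measurable_const)

theorem IsGibbs.lintegral_weightSum (hG : IsGibbs lam P) (hg : IsLocalWeight lam R g)
    (hΛ : MeasurableSet Λ) : ∫⁻ γ, weightSum g Λ γ ∂P =
      ∫⁻ γ, compensator (weightDensity lam g) Λ γ ∂P :=
  hG.lintegral_tsum_indicator hΛ hg.measurable

/-- The GNZ equation for the weights `g x γ * H x γ`. -/
theorem IsGibbs.lintegral_tsum_mul (hG : IsGibbs lam P) (hg : IsLocalWeight lam R g)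
    (hΛ : MeasurableSet Λ) {H : Pt d → Config d → ℝ≥0∞} (hH : Measurable (Function.uncurry H)) :
    ∫⁻ γ, ∑' x : γ.carrier, Λ.indicator 1 x.1 * g x.1 (γ.erase x.1) * H x.1 (γ.erase x.1) ∂P =
      ∫⁻ γ, ∫⁻ x in Λ, weightDensity lam g x γ * H x γ ∂volume ∂P := by
  have h := hG.lintegral_tsum_indicator hΛ (f := fun x γ => g x γ * H x γ) (hg.measurable.mul hH)
  simp only [← mul_assoc] at h
  rw [h]
  refine lintegral_congr fun γ => lintegral_congr fun x => ?_
  rw [weightDensity]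
  ring

theorem measurable_const_compensator (hg : IsLocalWeight lam R g)
    (hlam : Measurable fun q : Pt d × Config d => lam q.1 q.2.carrier) (hΛ : MeasurableSet Λ) :
    Measurable (compensator (weightDensity lam g) Λ) :=
  measurable_compensator (hg.measurable_density hlam) (L := fun _ => Λ) (measurable_snd hΛ)
    measurable_id

/-- Seen from a point x in Λ, N is one more than the number of the other points. This extra 1
produces the covariance E A. -/
theorem IsGibbs.lintegral_number_mul_weightSum (hG : IsGibbs lam P) (hg : IsLocalWeight lam R g)
    (hlam : Measurable fun q : Pt d × Config d => lam q.1 q.2.carrier) (hΛ : MeasurableSet Λ) :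
    ∫⁻ γ, Config.number Λ γ * weightSum g Λ γ ∂P =
      ∫⁻ γ, Config.number Λ γ * compensator (weightDensity lam g) Λ γ ∂P +
        ∫⁻ γ, compensator (weightDensity lam g) Λ γ ∂P := by
  have hm := measurable_const_compensator hg hlam hΛ
  rw [← lintegral_add_right _ hm]
  have h := hG.lintegral_tsum_mul hg hΛ (H := fun _ γ => Config.number Λ γ + 1)
    (((Config.measurable_number hΛ).comp measurable_snd).add_const 1)
  calc _ = _ := by
        refine lintegral_congr fun γ => ?_
        rw [weightSum, ← ENNReal.tsum_mul_left]
        refine tsum_congr fun x => ?_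
        by_cases hx : x.1 ∈ Λ
        · have : Config.number Λ γ = Config.number Λ (γ.erase x.1) + 1 := by
            rw [Config.number, γ.tsum_eq_add_tsum_erase x.2 (Λ.indicator 1), add_comm]
            simp [hx, Config.number]
          rw [this, mul_comm]
        · simp [hx]
    _ = _ := h
    _ = _ := by
        refine lintegral_congr fun γ => ?_
        have ha : Measurable fun x => weightDensity lam g x γ :=
          (hg.measurable_density hlam).comp measurable_prodMk_right
        rw [lintegral_mul_const _ ha]
        change compensator (weightDensity lam g) Λ γ * _ = _
        ring

/-- The mean of the far part of the product of a weighted sum and its compensator. -/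
noncomputable def farMoment (lam : Pt d → Set (Pt d) → ℝ≥0∞) (g : Pt d → Config d → ℝ≥0∞)
    (R : ℝ) (Λ : Set (Pt d)) (P : Measure (Config d)) : ℝ≥0∞ :=
  ∫⁻ γ, ∫⁻ x in Λ, weightDensity lam g x γ *
    compensator (weightDensity lam g) (Λ \ Metric.closedBall x R) γ ∂volume ∂P

theorem IsGibbs.lintegral_tsum_far (hG : IsGibbs lam P) (hg : IsLocalWeight lam R g)
    (hlam : Measurable fun q : Pt d × Config d => lam q.1 q.2.carrier) (hΛ : MeasurableSet Λ) :
    ∫⁻ γ, ∑' x : γ.carrier, Λ.indicator 1 x.1 * g x.1 (γ.erase x.1) *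
      compensator (weightDensity lam g) (Λ \ Metric.closedBall x.1 R) γ ∂P =
      farMoment lam g R Λ P := by
  rw [farMoment, ← hG.lintegral_tsum_mul hg hΛ (H := fun x γ =>
    compensator (weightDensity lam g) (Λ \ Metric.closedBall x R) γ)
    (measurable_compensator (hg.measurable_density hlam) (measurableSet_mem_far hΛ)
      measurable_snd)]
  simp only [hg.compensator_far_erase hΛ]

/-- Exchange the integral and the sum; the condition that x and y be more than R apart is symmetric.
With `IsGibbs.lintegral_tsum_far` this applies GNZ to the second variable of a pair. -/
theorem IsLocalWeight.lintegral_density_mul_weightSum_far (hg : IsLocalWeight lam R g)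
    (hlam : Measurable fun q : Pt d × Config d => lam q.1 q.2.carrier) (hΛ : MeasurableSet Λ)
    (γ : Config d) :
    ∫⁻ x in Λ, weightDensity lam g x γ * weightSum g (Λ \ Metric.closedBall x R) γ =
      ∑' x : γ.carrier, Λ.indicator 1 x.1 * g x.1 (γ.erase x.1) *
        compensator (weightDensity lam g) (Λ \ Metric.closedBall x.1 R) γ := by
  have := γ.countable_carrier.to_subtype
  have ha : Measurable fun x => weightDensity lam g x γ :=
    (hg.measurable_density hlam).comp measurable_prodMk_right
  simp only [weightSum, ← ENNReal.tsum_mul_left]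
  have hind : ∀ y : Pt d, Measurable fun x : Pt d =>
      (Λ \ Metric.closedBall x R).indicator (1 : Pt d → ℝ≥0∞) y := fun y =>
    ((measurable_one (α := ℝ≥0∞)).indicator (s := {q : Pt d × Pt d |
      q.2 ∈ Λ \ Metric.closedBall q.1 R}) ((measurable_snd hΛ).diff
        (measurableSet_le (measurable_snd.dist measurable_fst) measurable_const))).comp
      (measurable_id.prodMk measurable_const)
  have hterm : ∀ y : γ.carrier, AEMeasurable (fun x => weightDensity lam g x γ *
      ((Λ \ Metric.closedBall x R).indicator 1 y.1 * g y.1 (γ.erase y.1))) (volume.restrict Λ) :=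
    fun y => (ha.mul ((hind y.1).mul_const _)).aemeasurable
  rw [lintegral_tsum hterm]
  refine tsum_congr fun y => ?_
  rw [compensator, ← lintegral_const_mul _ ha, ← lintegral_indicator hΛ,
    ← lintegral_indicator (hΛ.diff measurableSet_closedBall)]
  refine lintegral_congr fun x => ?_
  have hsymm := dist_comm x y.1
  by_cases hx : x ∈ Λ <;> by_cases hy : y.1 ∈ Λ <;> by_cases hxy : dist x y.1 ≤ R <;>
    simp [Set.indicator, hx, hy, hxy, ← hsymm, mul_comm]

/-- For each point x, split the second factor at distance R. The far part does not see x and yields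
`farMoment`; the near part is at most 1, for x itself, plus the number of other points in the ball,
of mean at most z times its volume. -/
theorem IsGibbs.lintegral_weightSum_mul_self_le (hG : IsGibbs lam P) [IsProbabilityMeasure P]
    (hg : IsLocalWeight lam R g) (hR : 0 ≤ R)
    (hlam : Measurable fun q : Pt d × Config d => lam q.1 q.2.carrier)
    (hz : ∀ x γ, lam x γ ≤ z) (hΛ : MeasurableSet Λ) :
    ∫⁻ γ, weightSum g Λ γ * weightSum g Λ γ ∂P ≤ farMoment lam g R Λ P +
      z * (1 + z * volume (Metric.closedBall (0 : Pt d) R)) * volume Λ := by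
  have ha := hg.measurable_density hlam
  have hB : ∀ x : Pt d, volume (Metric.closedBall x R) = volume (Metric.closedBall (0 : Pt d) R) :=
    fun x => Measure.addHaar_closedBall_center _ x R
  have hmfar : Measurable fun q : Pt d × Config d =>
      weightSum g (Λ \ Metric.closedBall q.1 R) q.2 :=
    measurable_weightSum hg.measurable (measurableSet_mem_far hΛ) measurable_snd
  have hmnum : Measurable fun q : Pt d × Config d =>
      Config.number (Metric.closedBall q.1 R) q.2 :=
    Config.measurable_tsum measurable_snd
      (f := fun (q : Pt d × Config d) x => (Metric.closedBall q.1 R).indicator 1 x)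
      ((measurable_one (α := ℝ≥0∞)).indicator
        (s := {p : (Pt d × Config d) × Pt d | p.2 ∈ Metric.closedBall p.1.1 R})
        (measurableSet_le (measurable_snd.dist (measurable_fst.comp measurable_fst))
          measurable_const))
  have h := hG.lintegral_tsum_mul hg hΛ (H := fun x γ =>
    weightSum g (Λ \ Metric.closedBall x R) γ + (1 + Config.number (Metric.closedBall x R) γ))
    (hmfar.add (hmnum.const_add 1))
  calc ∫⁻ γ, weightSum g Λ γ * weightSum g Λ γ ∂P
      ≤ ∫⁻ γ, ∑' x : γ.carrier, Λ.indicator 1 x.1 * g x.1 (γ.erase x.1) *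
          (weightSum g (Λ \ Metric.closedBall x.1 R) (γ.erase x.1) +
            (1 + Config.number (Metric.closedBall x.1 R) (γ.erase x.1))) ∂P := by
        refine lintegral_mono fun γ => ?_
        conv_lhs => enter [1]; rw [weightSum]
        rw [← ENNReal.tsum_mul_right]
        refine ENNReal.tsum_le_tsum fun x => ?_
        rw [hg.weightSum_far_erase hR]
        gcongr
        refine (weightSum_le_add_number hg.le_one (Metric.closedBall x.1 R) γ).trans ?_
        gcongr
        rw [Config.number, γ.tsum_eq_add_tsum_erase x.2 ((Metric.closedBall x.1 R).indicator 1)]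
        simp [hR, Config.number]
    _ = ∫⁻ γ, ∫⁻ x in Λ, weightDensity lam g x γ * (weightSum g (Λ \ Metric.closedBall x R) γ +
          (1 + Config.number (Metric.closedBall x R) γ)) ∂volume ∂P := h
    _ ≤ ∫⁻ γ, ((∫⁻ x in Λ, weightDensity lam g x γ *
            weightSum g (Λ \ Metric.closedBall x R) γ) +
          ∫⁻ x in Λ, z * (1 + Config.number (Metric.closedBall x R) γ)) ∂P := by
        refine lintegral_mono fun γ => ?_
        rw [← lintegral_add_left]
        · refine lintegral_mono fun x => ?_
          rw [mul_add]
          gcongr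
          exact hg.density_le hz x γ
        · exact (ha.comp measurable_prodMk_right).mul (hmfar.comp measurable_prodMk_right)
    _ = farMoment lam g R Λ P + ∫⁻ γ, ∫⁻ x in Λ,
          z * (1 + Config.number (Metric.closedBall x R) γ) ∂volume ∂P := by
        rw [lintegral_add_right, ← hG.lintegral_tsum_far hg hlam hΛ]
        · simp only [hg.lintegral_density_mul_weightSum_far hlam hΛ]
        · exact Measurable.lintegral_prod_left'
            (f := fun q : Pt d × Config d => z * (1 + Config.number (Metric.closedBall q.1 R) q.2))
            ((hmnum.const_add 1).const_mul _)
    _ ≤ _ := by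
        gcongr
        rw [lintegral_lintegral_swap]
        · calc _ ≤ ∫⁻ x in Λ, z * (1 + z * volume (Metric.closedBall (0 : Pt d) R)) := by
                refine lintegral_mono fun x => ?_
                have hn : Measurable fun γ : Config d => Config.number (Metric.closedBall x R) γ :=
                  Config.measurable_number measurableSet_closedBall
                rw [lintegral_const_mul _ (hn.const_add 1), lintegral_add_left measurable_const,
                  lintegral_const, measure_univ, mul_one, ← hB x]
                gcongr
                exact hG.lintegral_number_le hz measurableSet_closedBall
            _ = _ := by simp
        · exact (((hmnum.const_add 1).const_mul _).comp measurable_swap).aemeasurable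

/-- The nonnegative contribution of near pairs is dropped; in E(S - A)² the mixed moment carries a
minus sign, so a lower bound suffices. -/
theorem IsGibbs.farMoment_le_lintegral_mul (hG : IsGibbs lam P)
    (hg : IsLocalWeight lam R g)
    (hlam : Measurable fun q : Pt d × Config d => lam q.1 q.2.carrier) (hΛ : MeasurableSet Λ) :
    farMoment lam g R Λ P ≤
      ∫⁻ γ, weightSum g Λ γ * compensator (weightDensity lam g) Λ γ ∂P := by
  rw [← hG.lintegral_tsum_far hg hlam hΛ]
  refine lintegral_mono fun γ => ?_
  rw [weightSum, ← ENNReal.tsum_mul_right]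
  refine ENNReal.tsum_le_tsum fun x => ?_
  gcongr
  exact lintegral_mono_set Set.sdiff_subset

theorem lintegral_compensator_mul_self_le [IsProbabilityMeasure P]
    (hg : IsLocalWeight lam R g)
    (hlam : Measurable fun q : Pt d × Config d => lam q.1 q.2.carrier)
    (hz : ∀ x γ, lam x γ ≤ z) (Λ : Set (Pt d)) :
    ∫⁻ γ, compensator (weightDensity lam g) Λ γ * compensator (weightDensity lam g) Λ γ ∂P ≤
      farMoment lam g R Λ P +
        z * (z * volume (Metric.closedBall (0 : Pt d) R)) * volume Λ := by
  have ha := hg.measurable_density hlam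
  have hm : ∀ γ, Measurable fun x => weightDensity lam g x γ := fun γ =>
    ha.comp measurable_prodMk_right
  rw [farMoment]
  calc _ ≤ ∫⁻ γ, ((∫⁻ x in Λ, weightDensity lam g x γ *
            compensator (weightDensity lam g) (Λ \ Metric.closedBall x R) γ) +
          z * (z * volume (Metric.closedBall (0 : Pt d) R)) * volume Λ) ∂P := by
        refine lintegral_mono fun γ => ?_
        conv_lhs => enter [1]; rw [compensator]
        rw [← lintegral_mul_const _ (hm γ)]
        calc _ ≤ ∫⁻ x in Λ, (weightDensity lam g x γ *
                compensator (weightDensity lam g) (Λ \ Metric.closedBall x R) γ +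
                z * (z * volume (Metric.closedBall (0 : Pt d) R))) := by
              refine lintegral_mono fun x => ?_
              have h1 : compensator (weightDensity lam g) Λ γ ≤
                  compensator (weightDensity lam g) (Λ \ Metric.closedBall x R) γ +
                    z * volume (Metric.closedBall (0 : Pt d) R) := by
                rw [← Measure.addHaar_closedBall_center volume x R]
                refine le_trans ?_ (add_le_add_right
                  (compensator_le (hg.density_le hz) (Metric.closedBall x R) γ) _)
                refine (lintegral_mono_set ?_).trans (lintegral_union_le _ _ _)
                rw [Set.sdiff_union_self]
                exact Set.subset_union_left
              refine (mul_le_mul_right h1 _).trans ?_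
              rw [mul_add]
              gcongr
              exact hg.density_le hz x γ
          _ = _ := by
              rw [lintegral_add_right _ measurable_const]
              simp
    _ = _ := by
        rw [lintegral_add_right _ measurable_const]
        simp

/-- Lower bound for the number variance by means of a local weight. -/
theorem IsGibbs.exists_mul_volume_le_evariance (hG : IsGibbs lam P) [IsProbabilityMeasure P]
    (hg : IsLocalWeight lam R g) (hR : 0 ≤ R)
    (hlam : Measurable fun q : Pt d × Config d => lam q.1 q.2.carrier)
    (hz : ∀ x γ, lam x γ ≤ z) (hz0 : 0 < z) {c : ℝ≥0} (hc : 0 < c)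
    (hint : ∀ Λ : Set (Pt d), MeasurableSet Λ → ∫⁻ γ, weightSum g Λ γ ∂P = c * volume Λ) :
    ∃ C : ℝ≥0, 0 < C ∧ ∀ Λ : Set (Pt d), Bornology.IsBounded Λ → MeasurableSet Λ →
      C * volume Λ ≤ evariance (Config.count Λ) P := by
  obtain ⟨v, hv⟩ : ∃ v : ℝ≥0, (v : ℝ≥0∞) = volume (Metric.closedBall (0 : Pt d) R) :=
    ⟨_, ENNReal.coe_toNNReal measure_closedBall_lt_top.ne⟩
  -- The near-pair constants of E S² and of E A², added.
  set K : ℝ≥0 := z * (1 + z * v) + z * (z * v) with hK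
  have hK0 : 0 < K := by positivity
  refine ⟨c ^ 2 / K, by positivity, fun Λ hb hΛ => ?_⟩
  have hΛf : volume Λ ≠ ∞ := hb.measure_lt_top.ne
  have hfin : ∀ γ : Config d, Config.number Λ γ ≠ ∞ := fun γ => by
    rw [Config.number, Config.tsum_indicator, ENat.toENNReal_ne_top, Set.encard_ne_top_iff]
    exact γ.locallyFinite Λ hb
  have hcomp : ∀ Λ' ⊆ Λ, ∀ γ, compensator (weightDensity lam g) Λ' γ ≤ z * volume Λ :=
    fun Λ' h γ => (compensator_le (hg.density_le hz) Λ' γ).trans (by gcongr)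
  have hzΛ : (z : ℝ≥0∞) * volume Λ ≠ ∞ := by finiteness
  have hEN := hG.lintegral_number_le hz hΛ
  have hm := Config.measurable_number (d := d) hΛ
  have hD : farMoment lam g R Λ P ≠ ∞ := by
    refine ne_top_of_le_ne_top (b := z * (z * volume Λ) * volume Λ) (by finiteness)
      (lintegral_le_of_forall_le fun γ => ?_)
    calc _ ≤ ∫⁻ x in Λ, z * (z * volume Λ) := by
          refine lintegral_mono fun x => ?_
          gcongr
          · exact hg.density_le hz x γ
          · exact hcomp _ Set.sdiff_subset γ
      _ = _ := by simp
  have hI : ∫⁻ γ, compensator (weightDensity lam g) Λ γ ∂P = c * volume Λ :=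
    (hG.lintegral_weightSum hg hΛ).symm.trans (hint Λ hΛ)
  have key := evariance_ge_of_moments (P := P) (X := Config.count Λ) (N := Config.number Λ)
    (S := weightSum g Λ) (A := compensator (weightDensity lam g) Λ)
    (D := farMoment lam g R Λ P) (E := K * volume Λ) hm
    (measurable_weightSum hg.measurable (L := fun _ => Λ) (measurable_snd hΛ) measurable_id)
    (measurable_const_compensator hg hlam hΛ)
    (fun γ => by
      rw [Config.number, Config.tsum_indicator, Config.count,
        ← (γ.locallyFinite Λ hb).cast_ncard_eq]
      simp)
    hfin (fun γ => ne_top_of_le_ne_top (hfin γ) (weightSum_le_number hg.le_one γ))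
    (fun γ => ne_top_of_le_ne_top hzΛ (hcomp Λ subset_rfl γ))
    (hG.lintegral_weightSum hg hΛ) (hG.lintegral_number_mul_weightSum hg hlam hΛ)
    (hG.farMoment_le_lintegral_mul hg hlam hΛ)
    (by
      refine (add_le_add (hG.lintegral_weightSum_mul_self_le hg hR hlam hz hΛ)
        (lintegral_compensator_mul_self_le hg hlam hz Λ)).trans_eq ?_
      rw [← hv, hK]
      push_cast
      ring)
    hD
    (by
      refine ne_top_of_le_ne_top (b := z * volume Λ * (z * volume Λ)) (by finiteness) ?_
      calc _ ≤ ∫⁻ γ, Config.number Λ γ * (z * volume Λ) ∂P := by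
            refine lintegral_mono fun γ => ?_
            gcongr
            exact hcomp Λ subset_rfl γ
        _ ≤ _ := by
            rw [lintegral_mul_const _ hm]
            gcongr)
    -- The value c/K maximises 2tc - t²K.
    (by rw [hI]; finiteness) (c / K)
  rw [hI] at key
  have h1 : ((c ^ 2 / K : ℝ≥0) : ℝ≥0∞) * volume Λ + ((c ^ 2 / K : ℝ≥0) : ℝ≥0∞) * volume Λ ≤
      evariance (Config.count Λ) P + ((c ^ 2 / K : ℝ≥0) : ℝ≥0∞) * volume Λ := by
    have e1 : (c / K) * c = c ^ 2 / K := by ring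
    have e2 : (c / K) ^ 2 * K = c ^ 2 / K := by
      field_simp
    calc _ = 2 * ((c / K : ℝ≥0) : ℝ≥0∞) * (c * volume Λ) := by
          rw [← e1]
          push_cast
          ring
      _ ≤ _ := key
      _ = _ := by
          rw [← e2]
          push_cast
          ring
  exact (ENNReal.add_le_add_iff_right (by finiteness)).1 h1

end Variance

/-! ### The surrounded weight and the conclusion -/

theorem surroundedIndicator_congr {d : ℕ} {T : Finset (Pt d)} {ρ : ℝ} {m : ℕ} {x x' : Pt d}
    {γ γ' : Config d}
    (h : IsSurrounded T ρ m x γ.carrier ↔ IsSurrounded T ρ m x' γ'.carrier) :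
    surroundedIndicator T ρ m x γ = surroundedIndicator T ρ m x' γ' := by
  unfold surroundedIndicator
  by_cases hx : IsSurrounded T ρ m x γ.carrier
  · rw [if_pos hx, if_pos (h.1 hx)]
  · rw [if_neg hx, if_neg (mt h.2 hx)]

theorem IsSphereNet.isLocalWeight {d : ℕ} {T : Finset (Pt d)} (hT : IsSphereNet T) {ρ : ℝ}
    (hρ : 0 < ρ) (z β : ℝ) (Φ : ℝ≥0 → ℝ≥0∞) (k : ℕ) :
    IsLocalWeight (papangelou z β Φ k) (4 * ρ) (surroundedIndicator T ρ (k + 1)) := by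
  have hs : ∀ x y (γ : Config d), 4 * ρ < dist x y →
      (IsSurrounded T ρ (k + 1) x (γ.erase y).carrier ↔ IsSurrounded T ρ (k + 1) x γ.carrier) :=
    fun x y γ h => hT.isSurrounded_sdiff_far hρ (by linarith)
  refine ⟨measurable_surroundedIndicator T ρ (k + 1), surroundedIndicator_le_one T ρ (k + 1),
    fun x y γ h => ?_, fun x y γ h => ?_⟩
  · exact surroundedIndicator_congr (hs x y γ h)
  · rw [surroundedIndicator_congr (hs x y γ h)]
    by_cases hx : IsSurrounded T ρ (k + 1) x γ.carrier
    · exact congrArg _ (hT.papangelou_sdiff_far hρ hx h)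
    -- At points that are not surrounded the intensity may have long range, but the weight vanishes.
    · simp [surroundedIndicator, hx]

theorem not_isHyperuniform_of_mul_volume_le {d : ℕ} {P : Measure (Config d)} {C : ℝ≥0}
    (hC : 0 < C) (h : ∀ Λ : Set (Pt d), Bornology.IsBounded Λ → MeasurableSet Λ →
      C * volume Λ ≤ evariance (Config.count Λ) P) : ¬ IsHyperuniform P := by
  intro hH
  have hlim := hH (fun n => Metric.ball 0 (n + 1))
    ⟨fun n => Metric.isBounded_ball, fun n => measurableSet_ball,
      fun a b hab => Metric.ball_subset_ball (by simpa using hab), by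
        refine Set.eq_univ_of_forall fun x => ?_
        obtain ⟨n, hn⟩ := exists_nat_gt ‖x‖
        exact Set.mem_iUnion.2 ⟨n, by rw [mem_ball_zero_iff]; linarith⟩⟩
  have hle : (C : ℝ≥0∞) ≤ 0 := by
    refine ge_of_tendsto' hlim fun n => ?_
    rw [ENNReal.le_div_iff_mul_le (Or.inl ?_) (Or.inl measure_ball_lt_top.ne)]
    · exact h _ Metric.isBounded_ball measurableSet_ball
    · exact (Metric.measure_ball_pos _ _ (by positivity)).ne'
  simp [hC.ne'] at hle

theorem corollaryC6 (d : ℕ) (hd : 1 ≤ d) (k : ℕ) (hk : 1 ≤ k) (z β : ℝ) (hz : 0 < z)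
    (hβ : 0 ≤ β) (Φ : ℝ≥0 → ℝ≥0∞) (hΦ : Antitone Φ)
    (P : Measure (Config d)) [IsProbabilityMeasure P] (hstat : IsStationaryProcess P)
    (hGibbs : IsGibbs (papangelou z β Φ k) P) :
    ¬ IsHyperuniform P ∧
      ∃ C : ℝ≥0, 0 < C ∧ ∀ Λ : Set (Pt d), Bornology.IsBounded Λ → MeasurableSet Λ →
        C * volume Λ ≤ evariance (Config.count Λ) P := by
  have hlam : Measurable fun q : Pt d × Config d => papangelou z β Φ k q.1 q.2.carrier :=
    measurable_papangelou hΦ measurable_snd z β k measurable_fst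
  have hle : ∀ (x : Pt d) γ, papangelou z β Φ k x γ ≤ (z.toNNReal : ℝ≥0∞) :=
    papangelou_le z β k
  have hempty := hGibbs.measure_empty hd (c := ENNReal.ofReal z)
    (by simpa using hz) (papangelou_empty z β k)
  have hinf : ∀ m : ℕ, P {γ | γ.carrier.encard ≤ m} = 0 := fun m => by
    refine measure_mono_null (fun γ hγ => ?_)
      (measure_union_null hempty (hstat.measure_encard_le_of_nonempty hd m))
    rcases γ.carrier.eq_empty_or_nonempty with h | h
    · exact Or.inl h
    · exact Or.inr ⟨hγ, h⟩
  obtain ⟨T, hT⟩ := exists_isSphereNet hd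
  obtain ⟨ρ, hρ, q, hpos⟩ := hstat.exists_lintegral_surrounded_pos hinf T k
  have hg := hT.isLocalWeight hρ z β Φ k
  have hsum : ∀ (B : Set (Pt d)) γ, weightSum (surroundedIndicator T ρ (k + 1)) B γ =
      ∑' x : γ.carrier, B.indicator 1 x.1 * surroundedIndicator T ρ (k + 1) x.1 γ :=
    fun B γ => tsum_congr fun x => by
      rw [surroundedIndicator_congr (γ := γ.erase x.1) (γ' := γ) (x' := x.1)
        (hT.isSurrounded_sdiff_self hρ)]
  obtain ⟨c, hc⟩ := hstat.exists_lintegral_tsum_eq hg.measurable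
    (fun u x γ => surroundedIndicator_congr isSurrounded_shift)
    fun K hK hKm => by
      simp only [← hsum]
      calc _ ≤ ∫⁻ γ, Config.number K γ ∂P :=
            lintegral_mono fun γ => weightSum_le_number hg.le_one γ
        _ ≤ _ := hGibbs.lintegral_number_le hle hKm
        _ < ∞ := ENNReal.mul_lt_top ENNReal.coe_lt_top hK.measure_lt_top
  -- If c were 0, the ball around the origin would contain no surrounded points in the mean.
  have hc0 : 0 < c := by
    rw [pos_iff_ne_zero]
    rintro rfl
    exact hpos (by simp [hc _ measurableSet_ball])
  obtain ⟨C, hC, hCV⟩ := hGibbs.exists_mul_volume_le_evariance hg (by positivity) hlam hle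
    (Real.toNNReal_pos.2 hz) hc0 fun Λ hΛ => by simp only [hsum, hc Λ hΛ]
  exact ⟨not_isHyperuniform_of_mul_volume_le hC hCV, C, hC, hCV⟩
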